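/- Let $X\in\mathbb R^{n\times p}$ be a fixed design matrix of rank $r_x$, let $q$ be the number of responses, and put $\bar r=\min(r_x,q)$. For a response matrix $Y\in\mathbb R^{n\times q}$ let $\widehat Y=X(X^\top X)^{+}X^\top Y$ be the least squares fit ($^+$ is the Moore–Penrose inverse), with singular value decomposition $\widehat Y=WDV^\top$, where $W\in\mathbb R^{n\times\bar r}$ and $V\in\mathbb R^{q\times\bar r}$ have orthonormal columns, $v_k$ is the $k$-th column of $V$, and $D=\mathrm{diag}(d_1,\dots,d_{\bar r})$ with $d_1\ge\dots\ge d_{\bar r}\ge 0$. For $1\le r\le\bar r$ let $\widehat Y(r)=\widehat Y\sum_{k=1}^{r}v_kv_k^\top$ be the rank-$r$ reduced-rank regression fit (for any choice of the decomposition, for each $Y$), and set $$\widehat{df}(r)=\begin{cases}\displaystyle \max(r_x,q)\,r+\sum_{k=1}^{r}\sum_{l=r+1}^{\bar r}\frac{d_k^2+d_l^2}{d_k^2-d_l^2}, & r<\bar r,\\[2mm] r_x q, & r=\bar r.\end{cases}$$ (1) At every $Y$ for which $d_1>\dots>d_{\bar r}>0$ (so that $\mathrm{rank}\,\widehat Y=\bar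 r$), the map $Y\mapsto\widehat Y(r)$ is differentiable, its divergence is $$\mathrm{tr}\left\{\frac{\partial\,\mathrm{vec}(\widehat Y(r))}{\partial\,\mathrm{vec}(Y)}\right\}=\sum_{i=1}^{n}\sum_{j=1}^{q}\frac{\partial\,\widehat Y(r)_{ij}}{\partial Y_{ij}}=\widehat{df}(r),$$ and $\widehat{df}(r)\ge(r_x+q-r)\,r$. (2) Let the entries $Y_{ij}$ be independent with $Y_{ij}\sim N(M_{ij},\sigma^2)$, where $M\in\mathbb R^{n\times q}$ is arbitrary and $\sigma^2>0$. Then almost surely $d_1>\dots>d_{\bar r}>0$, the entries of $\widehat Y(r)$ are square integrable, $\widehat{df}(r)$ is integrable, and $\widehat{df}(r)$ is an unbiased estimator of the effective degrees of freedom of $\widehat Y(r)$: $$\mathbb E\,\widehat{df}(r)=\frac1{\sigma^2}\sum_{i=1}^{n}\sum_{j=1}^{q}\mathrm{cov}\bigl(\widehat Y(r)_{ij},Y_{ij}\bigr).$$ -/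

import Mathlib

open Matrix MeasureTheory ProbabilityTheory
open scoped NNReal

/-- `G` is the Moore–Penrose inverse of the real matrix `A` (the four Penrose equations). -/
structure IsMoorePenrose {m n : ℕ} (A : Matrix (Fin m) (Fin n) ℝ)
    (G : Matrix (Fin n) (Fin m) ℝ) : Prop where
  mul_mul : A * G * A = A
  inv_mul_mul : G * A * G = G
  symm_left : (A * G)ᵀ = A * G
  symm_right : (G * A)ᵀ = G * A

theorem exists_isMoorePenrose_gram {n p : ℕ} (X : Matrix (Fin n) (Fin p) ℝ) :
    ∃ G : Matrix (Fin p) (Fin p) ℝ, IsMoorePenrose (Xᵀ * X) G := by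
  have hA : (Xᵀ * X).IsHermitian := by
    simpa using isHermitian_conjTranspose_mul_self X
  set U : Matrix (Fin p) (Fin p) ℝ := (hA.eigenvectorUnitary : Matrix (Fin p) (Fin p) ℝ)
  have hU : Uᵀ * U = 1 := by
    have := Unitary.coe_star_mul_self hA.eigenvectorUnitary
    simpa [star_eq_conjTranspose] using this
  set D : Matrix (Fin p) (Fin p) ℝ := diagonal hA.eigenvalues with hD
  set E : Matrix (Fin p) (Fin p) ℝ := diagonal fun i => (hA.eigenvalues i)⁻¹ with hE
  have hspec : Xᵀ * X = U * D * Uᵀ := by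
    have := hA.spectral_theorem
    simpa [Unitary.conjStarAlgAut_apply, star_eq_conjTranspose, Function.comp_def] using this
  have key : ∀ S T : Matrix (Fin p) (Fin p) ℝ,
      (U * S * Uᵀ) * (U * T * Uᵀ) = U * (S * T) * Uᵀ := by
    intro S T
    calc (U * S * Uᵀ) * (U * T * Uᵀ) = U * S * (Uᵀ * U) * T * Uᵀ := by
          simp only [Matrix.mul_assoc]
      _ = U * (S * T) * Uᵀ := by rw [hU]; simp only [Matrix.mul_one, Matrix.mul_assoc]
  have hDE : D * E * D = D := by
    simp only [hD, hE, diagonal_mul_diagonal]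
    congr 1; funext i; exact mul_inv_mul_cancel _
  have hED : E * D * E = E := by
    simp only [hD, hE, diagonal_mul_diagonal]
    congr 1; funext i
    by_cases h : hA.eigenvalues i = 0
    · simp [h]
    · field_simp
  refine ⟨U * E * Uᵀ, ?_, ?_, ?_, ?_⟩
  · rw [hspec, key, key, hDE]
  · rw [hspec, key, key, hED]
  · rw [hspec, key, hD, hE, diagonal_mul_diagonal]
    simp [Matrix.transpose_mul, Matrix.mul_assoc]
  · rw [hspec, key, hD, hE, diagonal_mul_diagonal]
    simp [Matrix.transpose_mul, Matrix.mul_assoc]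

/-- The Moore–Penrose inverse `(Xᵀ X)⁺`. -/
noncomputable def gramPinv {n p : ℕ} (X : Matrix (Fin n) (Fin p) ℝ) : Matrix (Fin p) (Fin p) ℝ :=
  Classical.choose (exists_isMoorePenrose_gram X)

/-- The least squares fit `Ŷ = X (Xᵀ X)⁺ Xᵀ Y`. -/
noncomputable def lsFit {n p q : ℕ} (X : Matrix (Fin n) (Fin p) ℝ)
    (Y : Matrix (Fin n) (Fin q) ℝ) : Matrix (Fin n) (Fin q) ℝ :=
  X * gramPinv X * Xᵀ * Y

/-- A thin singular value decomposition `A = W D Vᵀ` with `k` singular values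
`d 0 ≥ d 1 ≥ … ≥ d (k - 1) ≥ 0` (so `rank A ≤ k`); the columns of `W` and of `V` are
orthonormal. -/
structure ThinSVD {n q : ℕ} (A : Matrix (Fin n) (Fin q) ℝ) (k : ℕ) where
  W : Matrix (Fin n) (Fin k) ℝ
  d : Fin k → ℝ
  V : Matrix (Fin q) (Fin k) ℝ
  orthonormal_W : Wᵀ * W = 1
  orthonormal_V : Vᵀ * V = 1
  antitone_d : Antitone d
  nonneg_d : ∀ i, 0 ≤ d i
  eq_mul : A = W * diagonal d * Vᵀ

/-- Every real matrix of rank at most `k` has a thin singular value decomposition. -/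
theorem nonempty_thinSVD {n q : ℕ} (A : Matrix (Fin n) (Fin q) ℝ) (k : ℕ) (hrank : A.rank ≤ k)
    (hn : k ≤ n) (hq : k ≤ q) : Nonempty (ThinSVD A k) := by
  classical
  have hA : (Aᵀ * A).IsHermitian := by simpa using isHermitian_conjTranspose_mul_self A
  have hpsd : (Aᵀ * A).PosSemidef := by simpa using posSemidef_conjTranspose_mul_self A
  set lam := hA.eigenvalues with hlam
  have hlam0 : ∀ i, 0 ≤ lam i := fun i => hpsd.eigenvalues_nonneg i
  set U : Matrix (Fin q) (Fin q) ℝ := (hA.eigenvectorUnitary : Matrix (Fin q) (Fin q) ℝ)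
  have hU : Uᵀ * U = 1 := by
    have := Unitary.coe_star_mul_self hA.eigenvectorUnitary
    simpa [star_eq_conjTranspose] using this
  have hU' : U * Uᵀ = 1 := mul_eq_one_comm.mp hU
  have hspec : Aᵀ * A = U * diagonal lam * Uᵀ := by
    have := hA.spectral_theorem
    simpa [Unitary.conjStarAlgAut_apply, star_eq_conjTranspose, Function.comp_def] using this
  set C := A * U with hC
  have hAC : A = C * Uᵀ := by rw [hC, Matrix.mul_assoc, hU', Matrix.mul_one]
  have hCC : Cᵀ * C = diagonal lam := by
    calc Cᵀ * C = Uᵀ * (Aᵀ * A) * U := by simp only [hC, transpose_mul, Matrix.mul_assoc]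
      _ = (Uᵀ * U) * diagonal lam * (Uᵀ * U) := by rw [hspec]; simp only [Matrix.mul_assoc]
      _ = diagonal lam := by rw [hU]; simp
  have hCe : ∀ i j, ∑ a, C a i * C a j = if i = j then lam i else 0 := by
    intro i j
    have := congrFun (congrFun hCC i) j
    simpa [Matrix.mul_apply, diagonal_apply] using this
  set tau := Tuple.sort (fun i => -lam i)
  have htau : Antitone (fun i => lam (tau i)) := by
    intro i j hij
    have := Tuple.monotone_sort (fun i => -lam i) hij
    simpa using this
  have hzero : ∀ i : Fin q, k ≤ i.val → lam (tau i) = 0 := by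
    intro i hi
    by_contra hne
    have hr : A.rank = Fintype.card {i // lam i ≠ 0} := by
      rw [← hA.rank_eq_card_non_zero_eigs, rank_transpose_mul_self]
    have hpos : ∀ j : Fin (k + 1), lam (tau ⟨j, by omega⟩) ≠ 0 := by
      intro j
      have h1 : lam (tau i) ≤ lam (tau ⟨j, by omega⟩) :=
        htau (Fin.mk_le_of_le_val (by omega))
      have h2 := lt_of_le_of_ne (hlam0 (tau i)) (Ne.symm hne)
      exact (lt_of_lt_of_le h2 h1).ne'
    have := Fintype.card_le_of_injective
      (fun j : Fin (k + 1) => (⟨tau ⟨j, by omega⟩, hpos j⟩ : {i // lam i ≠ 0})) (by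
        intro a b hab
        have := tau.injective (Subtype.ext_iff.mp hab)
        exact Fin.ext (by simpa using this))
    rw [Fintype.card_fin] at this
    omega
  set t : Fin k → Fin q := fun i => tau (Fin.castLE hq i) with ht
  have htinj : Function.Injective t := tau.injective.comp (Fin.castLE_injective hq)
  let v : Fin n → EuclideanSpace ℝ (Fin n) := fun b =>
    if h : b.val < k then WithLp.toLp 2 (fun a => C a (t ⟨b, h⟩) / √(lam (t ⟨b, h⟩))) else 0
  let s : Set (Fin n) := {b | ∃ h : b.val < k, lam (t ⟨b, h⟩) ≠ 0}
  have hv : Orthonormal ℝ (s.domRestrict v) := by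
    rw [orthonormal_iff_ite]
    rintro ⟨b, hb, hb0⟩ ⟨c, hc, hc0⟩
    have hs : ∀ x : ℝ, 0 ≤ x → x ≠ 0 → √x * √x = x := fun x hx _ => Real.mul_self_sqrt hx
    have hin : inner ℝ (v b) (v c) = (∑ a, C a (t ⟨c, hc⟩) * C a (t ⟨b, hb⟩)) /
        (√(lam (t ⟨c, hc⟩)) * √(lam (t ⟨b, hb⟩))) := by
      simp only [v, dif_pos hb, dif_pos hc, PiLp.inner_apply, Finset.sum_div]
      refine Finset.sum_congr rfl fun a _ => ?_
      simp [div_mul_div_comm]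
    change inner ℝ (v b) (v c) = _
    rw [hin, hCe]
    by_cases hbc : b = c
    · subst hbc
      simp only [if_true]
      rw [Real.mul_self_sqrt (hlam0 _), div_self hb0]
    · have : t ⟨c, hc⟩ ≠ t ⟨b, hb⟩ := fun h => hbc (by
        have := htinj h
        simp only [Fin.mk.injEq] at this
        exact Fin.ext this.symm)
      rw [if_neg this, if_neg (by simpa using hbc), zero_div]
  obtain ⟨B, hB⟩ := hv.exists_orthonormalBasis_extension_of_card_eq (by simp)
  refine ⟨⟨of fun a i => B (Fin.castLE hn i) a, fun i => √(lam (t i)), of fun j i => U j (t i),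
    ?_, ?_, ?_, fun i => Real.sqrt_nonneg _, ?_⟩⟩
  · ext i j
    have := orthonormal_iff_ite.mp B.orthonormal (Fin.castLE hn j) (Fin.castLE hn i)
    simp only [PiLp.inner_apply, (Fin.castLE_injective hn).eq_iff] at this
    simpa [Matrix.mul_apply, one_apply, eq_comm] using this
  · ext i j
    have := congrFun (congrFun hU (t i)) (t j)
    simpa [Matrix.mul_apply, one_apply, htinj.eq_iff] using this
  · intro i j hij
    exact Real.sqrt_le_sqrt (htau (by simpa using hij))
  · have hcol : ∀ (a : Fin n) (i : Fin k),
        B (Fin.castLE hn i) a * √(lam (t i)) = C a (t i) := by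
      intro a i
      by_cases h0 : lam (t i) = 0
      · have := hCe (t i) (t i)
        rw [if_pos rfl, h0, Finset.sum_eq_zero_iff_of_nonneg
          (fun a _ => mul_self_nonneg _)] at this
        have := mul_self_eq_zero.mp (this a (Finset.mem_univ _))
        rw [h0, this]; simp
      · have hmem : Fin.castLE hn i ∈ s := ⟨i.2, h0⟩
        have hne : √(lam (t i)) ≠ 0 := by
          rw [Ne, Real.sqrt_eq_zero (hlam0 _)]; exact h0
        rw [hB _ hmem]
        simp only [v, Fin.val_castLE, i.2, dif_pos]
        exact div_mul_cancel₀ _ hne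
    have hCz : ∀ (a : Fin n) (i : Fin q), k ≤ i.val → C a (tau i) = 0 := by
      intro a i hi
      have := hCe (tau i) (tau i)
      rw [if_pos rfl, hzero i hi, Finset.sum_eq_zero_iff_of_nonneg
        (fun a _ => mul_self_nonneg _)] at this
      exact mul_self_eq_zero.mp (this a (Finset.mem_univ _))
    ext a j
    rw [hAC]
    rw [Matrix.mul_apply, Matrix.mul_apply]
    simp only [Matrix.mul_diagonal, transpose_apply, of_apply]
    rw [← Equiv.sum_comp tau]
    symm
    refine Finset.sum_of_injOn (Fin.castLE hq) (Fin.castLE_injective hq).injOn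
      (fun _ _ => by simp) ?_ ?_
    · intro i _ hi
      have : k ≤ i.val := by
        by_contra hlt
        exact hi ⟨⟨i, by omega⟩, by simp, rfl⟩
      rw [hCz a i this, zero_mul]
    · intro i _
      rw [hcol]

theorem rank_lsFit_le {n p q : ℕ} (X : Matrix (Fin n) (Fin p) ℝ) (Y : Matrix (Fin n) (Fin q) ℝ) :
    (lsFit X Y).rank ≤ min X.rank q := by
  refine le_min ?_ ?_
  · unfold lsFit
    simp only [Matrix.mul_assoc]
    exact rank_mul_le_left _ _
  · simpa using rank_le_width (lsFit X Y)

/-- The least squares fit always has a thin singular value decomposition with `min (rank X) q`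
singular values, so that a choice of decompositions as used below exists. -/
theorem nonempty_thinSVD_lsFit {n p q : ℕ} (X : Matrix (Fin n) (Fin p) ℝ)
    (Y : Matrix (Fin n) (Fin q) ℝ) : Nonempty (ThinSVD (lsFit X Y) (min X.rank q)) :=
  nonempty_thinSVD _ _ (rank_lsFit_le X Y)
    ((min_le_left _ _).trans (by simpa using X.rank_le_height)) (min_le_right _ _)

/-- The reduced-rank regression fit `Ŷ(r) = Ŷ ∑_{k ≤ r} v_k v_kᵀ`, where the `v_k` are the right
singular vectors of `Ŷ` in the chosen decomposition. -/
noncomputable def rrFit {n p q k : ℕ} (X : Matrix (Fin n) (Fin p) ℝ)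
    (S : ∀ Y : Matrix (Fin n) (Fin q) ℝ, ThinSVD (lsFit X Y) k) (r : ℕ)
    (Y : Matrix (Fin n) (Fin q) ℝ) : Matrix (Fin n) (Fin q) ℝ :=
  lsFit X Y * ∑ i : Fin k with i.val < r, vecMulVec (fun j => (S Y).V j i) (fun j => (S Y).V j i)

/-- The divergence `∑_{i,j} ∂ f_{ij} / ∂ y_{ij}` at `Y`, the trace of the Jacobian of `f`. -/
noncomputable def divergence {n q : ℕ}
    (f : Matrix (Fin n) (Fin q) ℝ → Matrix (Fin n) (Fin q) ℝ) (Y : Matrix (Fin n) (Fin q) ℝ) : ℝ :=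
  ∑ i, ∑ j, (fderiv ℝ f Y (Matrix.single i j 1)) i j

/-- The degrees of freedom estimate of the rank-`r` fit, as a function of the rank `rx` of the
design, the number `q` of responses and the singular values `d 0, d 1, …` of `Ŷ`. -/
noncomputable def dfHat (rx q r : ℕ) (d : Fin (min rx q) → ℝ) : ℝ :=
  if r < min rx q then
    (max rx q : ℕ) * (r : ℝ) +
      ∑ k : Fin (min rx q) with k.val < r, ∑ l : Fin (min rx q) with r ≤ l.val,
        (d k ^ 2 + d l ^ 2) / (d k ^ 2 - d l ^ 2)
  else (rx : ℝ) * q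

/-- The effective degrees of freedom `∑_{i,j} cov(f(Y)_{ij}, Y_{ij}) / σ²` of the fitting procedure
`f` applied to the random response matrix `Y` with error variance `σ2`. -/
noncomputable def effectiveDF {n q : ℕ} {Ω : Type*} [MeasurableSpace Ω] (P : Measure Ω)
    (Y : Ω → Matrix (Fin n) (Fin q) ℝ) (σ2 : ℝ≥0)
    (f : Matrix (Fin n) (Fin q) ℝ → Matrix (Fin n) (Fin q) ℝ) : ℝ :=
  (∑ i, ∑ j, covariance (fun ω => f (Y ω) i j) (fun ω => Y ω i j) P) / σ2

/-- `Y` is a Gaussian response matrix: independent entries `Y i j ~ N(M i j, σ2)`. -/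
structure IsGaussianResponse {n q : ℕ} {Ω : Type*} [MeasurableSpace Ω] (P : Measure Ω)
    (Y : Ω → Matrix (Fin n) (Fin q) ℝ) (M : Matrix (Fin n) (Fin q) ℝ) (σ2 : ℝ≥0) : Prop where
  hasLaw : ∀ i j, HasLaw (fun ω => Y ω i j) (gaussianReal (M i j) σ2) P
  indep : iIndepFun (fun (ij : Fin n × Fin q) ω => Y ω ij.1 ij.2) P

/-!
Write `Ŷ = P Y` with `P = X (Xᵀ X)⁺ Xᵀ`. The fit is `Ŷ(r) = Ŷ Q`, where `Q` is the projection onto the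
leading `r` eigenvectors of `A = Ŷᵀ Ŷ`; let `k = min (rank X) q`.

**Divergence.** Ky Fan's principle with a quantitative gap (`IsEigenDecomp.mul_sq_norm_sub_le`) says
that `Q` maximises `tr (A Q)` among projections of rank `r`, with a deficit controlling the distance
to the maximiser. Hence a spectral gap at one point makes `Q` Lipschitz at that point, for every
choice of eigenvectors, and `A Q = Q A`, `Q² = Q` then determine its derivative
(`hasMatDeriv_headProj`): in the eigenbasis it multiplies entry `(k, l)` of the increment of `A` by a
divided difference of the indicator of the first `r` indices. Taking the trace and symmetrising gives
`dfHat` (`sum_rrDeriv_single_apply`, `IsFullDecomp.dfHat_eq`).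

**Unbiasedness.** The claim is Stein's identity `E div f = σ⁻² E ⟨f(Y), Y - M⟩`, but `f = Ŷ(r)` is
discontinuous where the gap `γ = d_r² - d_{r+1}²` closes (for `r = k` the fit is
linear and there is no such difficulty). As a function of `A` the projection `Q` is Lipschitz with
constant `2 / γ`, so the field `γ / (γ + ε) f` is Lipschitz on balls
(`exists_lipschitzOnWith_regFit`). The gap is a combination of sums of leading eigenvalues, which
are Lipschitz everywhere and differentiable at gaps, and its derivative in the direction of `f` is
`2 d_r²`. So the regularised field has divergence `γ / (γ + ε) dfHat + 2 ε d_r² / (γ + ε)²`. This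
is nonnegative, it tends to `dfHat` as `ε → 0`, and it is at most `3 dfHat`, because `dfHat`
contains the summand `(d_r² + d_{r+1}²) / γ ≥ d_r² / γ`. Stein's identity for fields with
nonnegative divergence (`integrable_and_integral_divergence_gaussianVector`), Fatou's lemma and
dominated convergence then yield the integrability of `dfHat` and the identity for `f`. No
estimate on the law of `γ` near zero is needed.

All of this happens where the singular values are distinct and positive. For `B = Ŷ` of rank at most `k`
this means that the Hankel determinant of the traces of the powers of `Bᵀ B` is nonzero; as a polynomial
that does not vanish identically, it is nonzero almost everywhere (`ae_strictAnti_and_pos`).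
-/

/-! ### Frobenius norm, spectral decompositions and Ky Fan's principle -/

section Frobenius

attribute [local instance] Matrix.frobeniusNormedAddCommGroup Matrix.frobeniusNormedSpace

theorem frobenius_norm_sq_eq {m n : Type*} [Fintype m] [Fintype n] (A : Matrix m n ℝ) :
    ‖A‖ ^ 2 = ∑ i, ∑ j, A i j ^ 2 := by
  have h0 : 0 ≤ ∑ i, ∑ j, A i j ^ 2 := by positivity
  rw [Matrix.frobenius_norm_def, ← Real.sqrt_eq_rpow]
  simp only [Real.norm_eq_abs, Real.rpow_two, sq_abs]
  exact Real.sq_sqrt h0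

theorem trace_transpose_mul_self_eq {m n : Type*} [Fintype m] [Fintype n] (A : Matrix m n ℝ) :
    trace (Aᵀ * A) = ‖A‖ ^ 2 := by
  rw [frobenius_norm_sq_eq, Finset.sum_comm]
  simp [trace, Matrix.mul_apply, sq]

theorem abs_apply_le_frobenius {m n : Type*} [Fintype m] [Fintype n] (A : Matrix m n ℝ) (i : m)
    (j : n) : |A i j| ≤ ‖A‖ := by
  refine abs_le_of_sq_le_sq ?_ (norm_nonneg _)
  rw [frobenius_norm_sq_eq]
  calc A i j ^ 2 ≤ ∑ j, A i j ^ 2 :=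
        Finset.single_le_sum (f := fun j => A i j ^ 2) (fun _ _ => sq_nonneg _) (Finset.mem_univ j)
    _ ≤ ∑ i, ∑ j, A i j ^ 2 :=
        Finset.single_le_sum (f := fun i => ∑ j, A i j ^ 2)
          (fun _ _ => Finset.sum_nonneg fun _ _ => sq_nonneg _) (Finset.mem_univ i)

theorem abs_trace_transpose_mul_le {m n : Type*} [Fintype m] [Fintype n] (A B : Matrix m n ℝ) :
    |trace (Aᵀ * B)| ≤ ‖A‖ * ‖B‖ := by
  refine abs_le_of_sq_le_sq ?_ (by positivity)
  have h : trace (Aᵀ * B) = ∑ x : m × n, A x.1 x.2 * B x.1 x.2 := by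
    rw [Fintype.sum_prod_type, Finset.sum_comm]
    simp [trace, Matrix.mul_apply]
  rw [h, mul_pow, frobenius_norm_sq_eq, frobenius_norm_sq_eq]
  simp only [← Fintype.sum_prod_type']
  exact Finset.sum_mul_sq_le_sq_mul_sq _ _ _

end Frobenius

/-- `Q` is the orthogonal projection onto a subspace of dimension `r`. -/
structure IsRankProj {q : ℕ} (Q : Matrix (Fin q) (Fin q) ℝ) (r : ℕ) : Prop where
  symm : Qᵀ = Q
  idem : Q * Q = Q
  trace_eq : Q.trace = r

/-- A spectral decomposition `A = U diag(μ) Uᵀ` with `U` orthogonal and the eigenvalues in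
nonincreasing order. -/
structure IsEigenDecomp {q : ℕ} (A U : Matrix (Fin q) (Fin q) ℝ) (μ : Fin q → ℝ) : Prop where
  orth : Uᵀ * U = 1
  anti : Antitone μ
  eq_mul : A = U * diagonal μ * Uᵀ

/-- The indicator of the first `r` indices. -/
def headInd {q : ℕ} (r : ℕ) (k : Fin q) : ℝ := if k.val < r then 1 else 0

/-- The orthogonal projection onto the span of the first `r` columns of `U`. -/
def headProj {q : ℕ} (U : Matrix (Fin q) (Fin q) ℝ) (r : ℕ) : Matrix (Fin q) (Fin q) ℝ :=
  U * diagonal (headInd r) * Uᵀ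

/-- The sum of the first `r` entries of `μ`. -/
def headSum {q : ℕ} (μ : Fin q → ℝ) (r : ℕ) : ℝ := ∑ k, headInd r k * μ k

theorem headInd_mul_self {q : ℕ} (r : ℕ) (k : Fin q) : headInd r k * headInd r k = headInd r k := by
  unfold headInd; split_ifs <;> simp

theorem sum_headInd {q r : ℕ} (hr : r ≤ q) : ∑ k : Fin q, headInd r k = r := by
  have : ((Finset.univ : Finset (Fin q)).filter fun k => k.val < r).card = r := by
    rw [Fin.card_filter_val_lt]; omega
  simp [headInd, this]

/-- The trace of `U diag(a) Uᵀ Q` only sees the diagonal of `Uᵀ Q U`. -/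
theorem trace_conj_diagonal_mul {q : ℕ} (U Q : Matrix (Fin q) (Fin q) ℝ) (a : Fin q → ℝ) :
    trace (U * diagonal a * Uᵀ * Q) = ∑ k, a k * (Uᵀ * Q * U) k k := by
  have : trace (U * diagonal a * Uᵀ * Q) = trace (diagonal a * (Uᵀ * Q * U)) := by
    rw [Matrix.mul_assoc, Matrix.mul_assoc, trace_mul_comm]
    simp only [Matrix.mul_assoc]
  rw [this]
  simp [trace, diagonal_mul]

theorem conj_diagonal_mul_conj_diagonal {q : ℕ} {U : Matrix (Fin q) (Fin q) ℝ} (hU : Uᵀ * U = 1)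
    (a b : Fin q → ℝ) : U * diagonal a * Uᵀ * (U * diagonal b * Uᵀ)
      = U * diagonal (fun k => a k * b k) * Uᵀ := by
  calc _ = U * diagonal a * (Uᵀ * U) * diagonal b * Uᵀ := by simp only [Matrix.mul_assoc]
    _ = _ := by rw [hU, Matrix.mul_one, Matrix.mul_assoc U, diagonal_mul_diagonal]

theorem trace_conj_diagonal {q : ℕ} {U : Matrix (Fin q) (Fin q) ℝ} (hU : Uᵀ * U = 1)
    (a : Fin q → ℝ) : trace (U * diagonal a * Uᵀ) = ∑ k, a k := by
  rw [Matrix.mul_assoc, trace_mul_comm, Matrix.mul_assoc, hU, Matrix.mul_one, trace_diagonal]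

theorem transpose_conj_diagonal {q : ℕ} (U : Matrix (Fin q) (Fin q) ℝ)
    (a : Fin q → ℝ) : (U * diagonal a * Uᵀ)ᵀ = U * diagonal a * Uᵀ := by
  simp [Matrix.transpose_mul, Matrix.mul_assoc]

theorem isRankProj_headProj {q r : ℕ} (hr : r ≤ q) {U : Matrix (Fin q) (Fin q) ℝ}
    (hU : Uᵀ * U = 1) : IsRankProj (headProj U r) r where
  symm := transpose_conj_diagonal U _
  idem := by
    unfold headProj
    rw [conj_diagonal_mul_conj_diagonal hU]
    simp only [headInd_mul_self]
  trace_eq := by rw [headProj, trace_conj_diagonal hU, sum_headInd hr]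

theorem IsEigenDecomp.trace_mul_headProj {q : ℕ} {A U : Matrix (Fin q) (Fin q) ℝ} {μ : Fin q → ℝ}
    (h : IsEigenDecomp A U μ) (r : ℕ) : trace (A * headProj U r) = headSum μ r := by
  rw [h.eq_mul, headProj, conj_diagonal_mul_conj_diagonal h.orth, trace_conj_diagonal h.orth]
  simp only [headSum, mul_comm]

/-- The diagonal of an orthogonal projection, in any orthonormal basis, lies in `[0, 1]`. -/
theorem IsRankProj.conj_diag_mem_Icc {q r : ℕ} {Q U : Matrix (Fin q) (Fin q) ℝ}
    (hQ : IsRankProj Q r) (hU : U * Uᵀ = 1) (k : Fin q) :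
    (Uᵀ * Q * U) k k ∈ Set.Icc (0 : ℝ) 1 := by
  set T := Uᵀ * Q * U with hT
  have hTT : Tᵀ * T = T := by
    calc Tᵀ * T = Uᵀ * Qᵀ * (U * Uᵀ) * Q * U := by
          simp only [hT, transpose_mul, transpose_transpose, Matrix.mul_assoc]
      _ = Uᵀ * (Q * Q) * U := by rw [hU, hQ.symm, Matrix.mul_one]; simp only [Matrix.mul_assoc]
      _ = T := by rw [hQ.idem]
  have h1 : T k k = ∑ j, T j k ^ 2 := by
    conv_lhs => rw [← hTT]
    simp [Matrix.mul_apply, sq]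
  have h0 : T k k ^ 2 ≤ T k k := by
    conv_rhs => rw [h1]
    exact Finset.single_le_sum (f := fun j => T j k ^ 2) (fun _ _ => sq_nonneg _)
      (Finset.mem_univ k)
  constructor
  · exact (sq_nonneg _).trans h0
  · nlinarith [sq_nonneg (T k k - 1)]

section KyFan

attribute [local instance] Matrix.frobeniusNormedAddCommGroup Matrix.frobeniusNormedSpace

/-- Ky Fan's maximum principle with a quantitative gap: the projection onto the leading `r`
eigenvectors maximises `tr (A Q)` over rank `r` projections, and the deficit controls the squared
distance to the maximiser. -/
theorem IsEigenDecomp.mul_sq_norm_sub_le {q r : ℕ} (hr : r ≤ q) {A U Q : Matrix (Fin q) (Fin q) ℝ}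
    {μ : Fin q → ℝ} (h : IsEigenDecomp A U μ) (hQ : IsRankProj Q r) {c γ : ℝ}
    (hhead : ∀ k : Fin q, k.val < r → c + γ ≤ μ k) (htail : ∀ l : Fin q, r ≤ l.val → μ l ≤ c) :
    γ / 2 * ‖headProj U r - Q‖ ^ 2 ≤ trace (A * (headProj U r - Q)) := by
  have hU' : U * Uᵀ = 1 := mul_eq_one_comm.mp h.orth
  have hP := isRankProj_headProj hr h.orth
  set T := Uᵀ * Q * U with hT
  have htr : ∑ k, T k k = r := by
    rw [← hQ.trace_eq]
    change trace T = _
    rw [hT, trace_mul_comm, ← Matrix.mul_assoc, hU', Matrix.one_mul]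
  have hAQ : trace (A * (headProj U r - Q)) = ∑ k, μ k * (headInd r k - T k k) := by
    rw [Matrix.mul_sub, trace_sub, h.trace_mul_headProj, h.eq_mul, trace_conj_diagonal_mul,
      headSum, ← Finset.sum_sub_distrib]
    exact Finset.sum_congr rfl fun k _ => by ring
  have hPQ : trace (headProj U r * Q) = ∑ k, headInd r k * T k k := trace_conj_diagonal_mul _ _ _
  have hnorm : ‖headProj U r - Q‖ ^ 2 = ∑ k, (headInd r k + T k k - 2 * headInd r k * T k k) := by
    rw [← trace_transpose_mul_self_eq, transpose_sub, hP.symm, hQ.symm, Matrix.sub_mul,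
      Matrix.mul_sub, Matrix.mul_sub, hP.idem, hQ.idem]
    simp only [trace_sub]
    rw [trace_mul_comm Q, hPQ, hP.trace_eq, hQ.trace_eq, Finset.sum_sub_distrib,
      Finset.sum_add_distrib, htr, sum_headInd hr]
    simp only [mul_assoc, ← Finset.mul_sum]
    ring
  have hshift : ∑ k, μ k * (headInd r k - T k k)
      = ∑ k, (μ k - (c + γ / 2)) * (headInd r k - T k k) := by
    have : ∑ k, (c + γ / 2) * (headInd r k - T k k) = 0 := by
      rw [← Finset.mul_sum, Finset.sum_sub_distrib, htr, sum_headInd hr]; ring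
    simp only [sub_mul (μ _), Finset.sum_sub_distrib, this, sub_zero]
  rw [hAQ, hshift, hnorm, Finset.mul_sum]
  refine Finset.sum_le_sum fun k _ => ?_
  obtain ⟨h0, h1⟩ := hQ.conj_diag_mem_Icc hU' k
  change 0 ≤ T k k at h0
  change T k k ≤ 1 at h1
  unfold headInd
  split_ifs with hk
  · nlinarith [mul_nonneg (sub_nonneg.2 (hhead k hk)) (sub_nonneg.2 h1)]
  · nlinarith [mul_nonneg (sub_nonneg.2 (htail k (not_lt.1 hk))) h0]

/-- Every nonincreasing sequence of eigenvalues is separated at `r` by some threshold. -/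
theorem Antitone.exists_threshold {q : ℕ} {μ : Fin q → ℝ} (hμ : Antitone μ) (r : ℕ) :
    ∃ c : ℝ, (∀ k : Fin q, k.val < r → c + 0 ≤ μ k) ∧ ∀ l : Fin q, r ≤ l.val → μ l ≤ c := by
  by_cases hr : r < q
  · exact ⟨μ ⟨r, hr⟩, fun k hk => by
      rw [add_zero]; exact hμ (Fin.mk_le_of_le_val (by simpa using hk.le)),
      fun l hl => hμ (Fin.mk_le_of_le_val hl)⟩
  · by_cases hq : 0 < q
    · exact ⟨μ ⟨q - 1, by omega⟩, fun k _ => by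
        rw [add_zero]; exact hμ (Fin.le_def.2 (by simp; omega)), fun l hl => by omega⟩
    · exact ⟨0, fun k => by omega, fun l => by omega⟩

theorem IsEigenDecomp.trace_mul_sub_nonneg {q r : ℕ} (hr : r ≤ q)
    {A U Q : Matrix (Fin q) (Fin q) ℝ} {μ : Fin q → ℝ} (h : IsEigenDecomp A U μ)
    (hQ : IsRankProj Q r) : 0 ≤ trace (A * (headProj U r - Q)) := by
  obtain ⟨c, h1, h2⟩ := h.anti.exists_threshold r
  simpa using h.mul_sq_norm_sub_le hr hQ h1 h2

theorem IsEigenDecomp.isSymm {q : ℕ} {A U : Matrix (Fin q) (Fin q) ℝ} {μ : Fin q → ℝ}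
    (h : IsEigenDecomp A U μ) : Aᵀ = A := by
  rw [h.eq_mul, transpose_conj_diagonal]

/-- A spectral gap at one of the two matrices already makes the leading eigenprojections
Lipschitz close. -/
theorem IsEigenDecomp.norm_headProj_sub_le {q r : ℕ} (hr : r ≤ q)
    {A U A' U' : Matrix (Fin q) (Fin q) ℝ} {μ μ' : Fin q → ℝ} (h : IsEigenDecomp A U μ)
    (h' : IsEigenDecomp A' U' μ') {c γ : ℝ} (hγ : 0 < γ)
    (hhead : ∀ k : Fin q, k.val < r → c + γ ≤ μ k) (htail : ∀ l : Fin q, r ≤ l.val → μ l ≤ c) :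
    ‖headProj U r - headProj U' r‖ ≤ 2 / γ * ‖A - A'‖ := by
  have h1 := h.mul_sq_norm_sub_le hr (isRankProj_headProj hr h'.orth) hhead htail
  have h2 := h'.trace_mul_sub_nonneg hr (isRankProj_headProj hr h.orth)
  have h3 := abs_trace_transpose_mul_le (A - A') (headProj U r - headProj U' r)
  have h4 : trace ((A - A')ᵀ * (headProj U r - headProj U' r))
      = trace (A * (headProj U r - headProj U' r)) + trace (A' * (headProj U' r - headProj U r)) := by
    rw [transpose_sub, h.isSymm, h'.isSymm, ← trace_add]
    congr 1
    noncomm_ring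
  have h5 := le_abs_self (trace ((A - A')ᵀ * (headProj U r - headProj U' r)))
  set N := ‖headProj U r - headProj U' r‖
  have hN : 0 ≤ N := norm_nonneg _
  rcases hN.eq_or_lt with h0 | h0
  · rw [← h0]; positivity
  · have : γ / 2 * N ≤ ‖A - A'‖ := by
      refine le_of_mul_le_mul_right ?_ h0
      nlinarith
    rw [div_mul_eq_mul_div, le_div_iff₀ hγ]
    linarith

theorem norm_headProj_le {q r : ℕ} (hr : r ≤ q) {U : Matrix (Fin q) (Fin q) ℝ}
    (hU : Uᵀ * U = 1) : ‖headProj U r‖ ≤ √r := by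
  have h := isRankProj_headProj hr hU
  refine Real.le_sqrt_of_sq_le ?_
  rw [← trace_transpose_mul_self_eq, h.symm, h.idem, h.trace_eq]

theorem IsEigenDecomp.headSum_sub_le {q r : ℕ} (hr : r ≤ q)
    {A U A' U' : Matrix (Fin q) (Fin q) ℝ} {μ μ' : Fin q → ℝ} (h : IsEigenDecomp A U μ)
    (h' : IsEigenDecomp A' U' μ') : headSum μ r - headSum μ' r ≤ √r * ‖A - A'‖ := by
  have h2 := h'.trace_mul_sub_nonneg hr (isRankProj_headProj hr h.orth)
  have h3 := abs_trace_transpose_mul_le (A - A') (headProj U r)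
  have h4 : trace ((A - A')ᵀ * headProj U r)
      = headSum μ r - headSum μ' r + trace (A' * (headProj U' r - headProj U r)) := by
    rw [transpose_sub, h.isSymm, h'.isSymm, ← h.trace_mul_headProj, ← h'.trace_mul_headProj,
      Matrix.sub_mul, Matrix.mul_sub]
    simp only [trace_sub]
    ring
  have h5 := le_abs_self (trace ((A - A')ᵀ * headProj U r))
  have h6 := mul_le_mul_of_nonneg_left (norm_headProj_le hr h.orth) (norm_nonneg (A - A'))
  linarith

/-- The sum of the leading `r` eigenvalues is Lipschitz. -/
theorem IsEigenDecomp.abs_headSum_sub_le {q r : ℕ} (hr : r ≤ q)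
    {A U A' U' : Matrix (Fin q) (Fin q) ℝ} {μ μ' : Fin q → ℝ} (h : IsEigenDecomp A U μ)
    (h' : IsEigenDecomp A' U' μ') : |headSum μ r - headSum μ' r| ≤ √r * ‖A - A'‖ := by
  rw [abs_le]
  have h1 := h.headSum_sub_le hr h'
  have h2 := h'.headSum_sub_le hr h
  rw [norm_sub_rev] at h2
  constructor <;> linarith

/-- First order expansion of the sum of the leading eigenvalues (envelope theorem): both
projections nearly maximise `tr (A Q)`, so only the explicit dependence on the matrix matters. -/
theorem IsEigenDecomp.abs_headSum_sub_sub_le {q r : ℕ} (hr : r ≤ q)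
    {A U A' U' : Matrix (Fin q) (Fin q) ℝ} {μ μ' : Fin q → ℝ} (h : IsEigenDecomp A U μ)
    (h' : IsEigenDecomp A' U' μ') {c γ : ℝ} (hγ : 0 < γ)
    (hhead : ∀ k : Fin q, k.val < r → c + γ ≤ μ k) (htail : ∀ l : Fin q, r ≤ l.val → μ l ≤ c) :
    |headSum μ' r - headSum μ r - trace ((A' - A) * headProj U r)| ≤ 2 / γ * ‖A' - A‖ ^ 2 := by
  have h1 := h'.trace_mul_sub_nonneg hr (isRankProj_headProj hr h.orth)
  have h2 := h.trace_mul_sub_nonneg hr (isRankProj_headProj hr h'.orth)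
  have h3 := abs_trace_transpose_mul_le (A' - A) (headProj U' r - headProj U r)
  have h4 := h.norm_headProj_sub_le hr h' hγ hhead htail
  rw [norm_sub_rev, norm_sub_rev A] at h4
  have h5 := le_abs_self (trace ((A' - A)ᵀ * (headProj U' r - headProj U r)))
  have h6 := mul_le_mul_of_nonneg_left h4 (norm_nonneg (A' - A))
  have e1 : headSum μ' r - headSum μ r - trace ((A' - A) * headProj U r)
      = trace (A' * (headProj U' r - headProj U r)) := by
    rw [← h.trace_mul_headProj, ← h'.trace_mul_headProj, Matrix.sub_mul, Matrix.mul_sub]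
    simp only [trace_sub]
    ring
  have e2 : trace (A' * (headProj U' r - headProj U r))
      = trace ((A' - A)ᵀ * (headProj U' r - headProj U r))
        - trace (A * (headProj U r - headProj U' r)) := by
    rw [transpose_sub, h.isSymm, h'.isSymm, ← trace_sub]
    congr 1
    noncomm_ring
  rw [e1, abs_of_nonneg h1, e2]
  nlinarith

end KyFan

/-! ### Differentiability of leading eigenprojections and eigenvalue sums -/

section Derivative

open Filter Asymptotics Topology

attribute [local instance] Matrix.frobeniusNormedAddCommGroup Matrix.frobeniusNormedSpace

/-- If one factor vanishes at the point, the product rule needs only continuity of the other. -/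
theorem HasFDerivAt.mul_of_continuousAt_of_eq_zero {E : Type*} [NormedAddCommGroup E]
    [NormedSpace ℝ E] {f g : E → ℝ} {g' : E →L[ℝ] ℝ} {x : E} (hf : ContinuousAt f x)
    (hg : HasFDerivAt g g' x) (h0 : g x = 0) :
    HasFDerivAt (fun y => f y * g y) (f x • g') x := by
  have h1 : HasFDerivAt (fun y => (f y - f x) * g y) (0 : E →L[ℝ] ℝ) x := by
    rw [hasFDerivAt_iff_isLittleO]
    have ho : (fun y => f y - f x) =o[𝓝 x] fun _ => (1 : ℝ) := by
      rw [isLittleO_one_iff]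
      simpa using (hf.tendsto.sub_const (f x))
    have hO : g =O[𝓝 x] fun y => y - x := by simpa [h0] using hg.isBigO_sub
    have := ho.mul_isBigO hO.norm_right
    simpa [h0] using this
  have h2 := (hg.const_mul (f x)).add h1
  rw [add_zero] at h2
  refine h2.congr_of_eventuallyEq (Eventually.of_forall fun y => ?_)
  simp only [Pi.add_apply]
  ring

/-- `f` is differentiable at `x` entry by entry, with derivative the (linear) map `G`. Working with
entries keeps norms on matrices out of the differential calculus. -/
def HasMatDeriv {E : Type*} [NormedAddCommGroup E] [NormedSpace ℝ E] {m n : Type*}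
    (f : E → Matrix m n ℝ) (G : E → Matrix m n ℝ) (x : E) : Prop :=
  ∀ i j, ∃ f' : E →L[ℝ] ℝ, HasFDerivAt (fun y => f y i j) f' x ∧ ∀ H, f' H = G H i j

section HasMatDeriv

variable {E : Type*} [NormedAddCommGroup E] [NormedSpace ℝ E] {l m n : Type*}
  {f f' : E → Matrix l m ℝ} {x : E}

theorem HasMatDeriv.const_mul [Fintype l] (hf : HasMatDeriv f f' x) (B : Matrix n l ℝ) :
    HasMatDeriv (fun y => B * f y) (fun H => B * f' H) x := by
  intro i j
  choose d hd hd' using hf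
  refine ⟨_, HasFDerivAt.fun_sum (u := Finset.univ) fun k _ => (hd k j).const_mul (B i k), ?_⟩
  intro H
  simp [Matrix.mul_apply, hd']

theorem HasMatDeriv.mul_const [Fintype m] (hf : HasMatDeriv f f' x) (B : Matrix m n ℝ) :
    HasMatDeriv (fun y => f y * B) (fun H => f' H * B) x := by
  intro i j
  choose d hd hd' using hf
  refine ⟨_, HasFDerivAt.fun_sum (u := Finset.univ) fun k _ => (hd i k).mul_const (B k j), ?_⟩
  intro H
  simp [Matrix.mul_apply, hd', mul_comm]

theorem HasMatDeriv.mul [Fintype m] {h h' : E → Matrix m n ℝ} (hf : HasMatDeriv f f' x)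
    (hh : HasMatDeriv h h' x) :
    HasMatDeriv (fun y => f y * h y) (fun H => f' H * h x + f x * h' H) x := by
  intro i j
  choose d hd hd' using hf
  choose e he he' using hh
  refine ⟨_, HasFDerivAt.fun_sum (u := Finset.univ) fun k _ => (hd i k).mul (he k j), ?_⟩
  intro H
  simp [Matrix.mul_apply, hd', he', mul_comm, Finset.sum_add_distrib, add_comm]

theorem HasMatDeriv.transpose (hf : HasMatDeriv f f' x) :
    HasMatDeriv (fun y => (f y)ᵀ) (fun H => (f' H)ᵀ) x := fun i j => hf j i

theorem HasMatDeriv.sub_const (hf : HasMatDeriv f f' x) (B : Matrix l m ℝ) :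
    HasMatDeriv (fun y => f y - B) f' x := fun i j => by
  obtain ⟨d, hd, hd'⟩ := hf i j
  exact ⟨d, hd.sub_const (B i j), hd'⟩

theorem HasMatDeriv.isBigO_sub [Fintype l] [Fintype m] (hf : HasMatDeriv f f' x) :
    (fun y => f y - f x) =O[𝓝 x] fun y => y - x := by
  classical
  have h1 : (fun y => ∑ i, ∑ j, (f y i j - f x i j) • Matrix.single i j (1 : ℝ))
      =O[𝓝 x] fun y => y - x := by
    refine IsBigO.fun_sum fun i _ => IsBigO.fun_sum fun j _ => ?_
    obtain ⟨d, hd, -⟩ := hf i j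
    have h2 := hd.isBigO_sub.norm_right
    have h3 : (fun y => (f y i j - f x i j) • Matrix.single i j (1 : ℝ))
        =O[𝓝 x] fun y => f y i j - f x i j := by
      refine IsBigO.of_bound ‖Matrix.single i j (1 : ℝ)‖ (Eventually.of_forall fun y => ?_)
      rw [norm_smul, mul_comm]
    exact h3.trans h2.of_norm_right
  refine h1.congr_left fun y => ?_
  conv_rhs => rw [matrix_eq_sum_single (f y - f x)]
  simp

end HasMatDeriv

/-- The leading eigenprojection is differentiable wherever there is a gap, whatever the choice of
eigenvectors; in the eigenbasis the derivative is the Hadamard product with the divided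
differences of the indicator. The off-diagonal blocks are read off from `A Q = Q A`, and the
diagonal blocks are of second order because `Q` is a projection. -/
theorem hasMatDeriv_headProj {E : Type*} [NormedAddCommGroup E] [NormedSpace ℝ E]
    {q r : ℕ} (hr : r ≤ q) {A U : E → Matrix (Fin q) (Fin q) ℝ} {μ : E → Fin q → ℝ}
    (h : ∀ x, IsEigenDecomp (A x) (U x) (μ x)) {x₀ : E} {A' : E → Matrix (Fin q) (Fin q) ℝ}
    (hA : HasMatDeriv A A' x₀) {c γ : ℝ} (hγ : 0 < γ)
    (hhead : ∀ k : Fin q, k.val < r → c + γ ≤ μ x₀ k)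
    (htail : ∀ l : Fin q, r ≤ l.val → μ x₀ l ≤ c) :
    HasMatDeriv (fun x => headProj (U x) r) (fun H =>
        U x₀ * (of fun k l => (headInd r k - headInd r l) / (μ x₀ k - μ x₀ l) *
          ((U x₀)ᵀ * A' H * U x₀) k l) * (U x₀)ᵀ) x₀ := by
  have hU : (U x₀)ᵀ * U x₀ = 1 := (h x₀).orth
  have hU' : U x₀ * (U x₀)ᵀ = 1 := mul_eq_one_comm.mp hU
  set V := U x₀ with hV
  set D : Matrix (Fin q) (Fin q) ℝ := diagonal (headInd r) with hD
  -- everything is expressed in the eigenbasis at the base point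
  set T : E → Matrix (Fin q) (Fin q) ℝ := fun x => Vᵀ * headProj (U x) r * V with hT
  set K : E → Matrix (Fin q) (Fin q) ℝ := fun x => Vᵀ * (A x - A x₀) * V with hK
  have hT0 : T x₀ = D := by
    simp only [hT, headProj, ← hV]
    calc _ = (Vᵀ * V) * D * (Vᵀ * V) := by simp only [Matrix.mul_assoc, hD]
      _ = D := by simp [hU]
  have hTidem : ∀ x, T x * T x = T x := fun x => by
    calc T x * T x = Vᵀ * (headProj (U x) r * (V * Vᵀ) * headProj (U x) r) * V := by
          simp only [hT, Matrix.mul_assoc]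
      _ = T x := by rw [hU', Matrix.mul_one, (isRankProj_headProj hr (h x).orth).idem]
  -- the projection is Lipschitz at the base point
  have hO : (fun x => headProj (U x) r - headProj V r) =O[𝓝 x₀] fun x => x - x₀ := by
    have : (fun x => headProj (U x) r - headProj V r) =O[𝓝 x₀] fun x => A x - A x₀ := by
      refine IsBigO.of_bound (2 / γ) (Eventually.of_forall fun x => ?_)
      rw [norm_sub_rev, norm_sub_rev (A x)]
      exact (h x₀).norm_headProj_sub_le hr (h x) hγ hhead htail
    exact this.trans hA.isBigO_sub
  have hNO : ∀ k l, (fun x => T x k l - D k l) =O[𝓝 x₀] fun x => x - x₀ := fun k l => by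
    refine (IsBigO.of_bound (‖Vᵀ‖ * ‖V‖) (Eventually.of_forall fun x => ?_)).trans hO
    have e : T x k l - D k l = (Vᵀ * (headProj (U x) r - headProj V r) * V) k l := by
      rw [← hT0]
      simp only [hT, Matrix.mul_sub, Matrix.sub_mul, Matrix.sub_apply, ← hV]
    rw [e, Real.norm_eq_abs]
    calc _ ≤ ‖Vᵀ * (headProj (U x) r - headProj V r) * V‖ := abs_apply_le_frobenius _ _ _
      _ ≤ ‖Vᵀ * (headProj (U x) r - headProj V r)‖ * ‖V‖ := frobenius_norm_mul _ _
      _ ≤ ‖Vᵀ‖ * ‖headProj (U x) r - headProj V r‖ * ‖V‖ := by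
          gcongr; exact frobenius_norm_mul _ _
      _ = _ := by ring
  have hTcont : ∀ k l, ContinuousAt (fun x => T x k l) x₀ := fun k l => by
    have h1 : Tendsto (fun x : E => x - x₀) (𝓝 x₀) (𝓝 0) := by
      simpa using (tendsto_id (x := 𝓝 x₀)).sub_const x₀
    have h2 := (hNO k l).trans_tendsto h1
    have h3 := h2.add_const (D k l)
    simp only [sub_add_cancel, zero_add] at h3
    rw [ContinuousAt, hT0]
    exact h3
  have hKd : HasMatDeriv K (fun H => Vᵀ * A' H * V) x₀ :=
    ((hA.sub_const (A x₀)).const_mul Vᵀ).mul_const V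
  choose K' hK' hK'' using hKd
  have hK0 : ∀ k l, K x₀ k l = 0 := fun k l => by simp [hK]
  have hcomm : ∀ x k l, (μ x₀ k - μ x₀ l) * T x k l
      = ∑ j, T x k j * K x j l - ∑ j, T x j l * K x k j := fun x k l => by
    have e0 : Vᵀ * A x₀ * V = diagonal (μ x₀) := by
      rw [(h x₀).eq_mul]
      calc _ = (Vᵀ * V) * diagonal (μ x₀) * (Vᵀ * V) := by simp only [Matrix.mul_assoc, hV]
        _ = _ := by simp [hU]
    have e1 : A x * headProj (U x) r = headProj (U x) r * A x := by
      rw [(h x).eq_mul, headProj, conj_diagonal_mul_conj_diagonal (h x).orth,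
        conj_diagonal_mul_conj_diagonal (h x).orth]
      simp only [mul_comm]
    have key : ∀ B C : Matrix (Fin q) (Fin q) ℝ, (Vᵀ * B * V) * (Vᵀ * C * V) = Vᵀ * (B * C) * V :=
      fun B C => by
      calc _ = Vᵀ * B * (V * Vᵀ) * C * V := by simp only [Matrix.mul_assoc]
        _ = _ := by rw [hU', Matrix.mul_one]; simp only [Matrix.mul_assoc]
    have e2 : diagonal (μ x₀) * T x - T x * diagonal (μ x₀) = T x * K x - K x * T x := by
      rw [← e0]
      simp only [hT, hK, key]
      simp only [Matrix.mul_sub, Matrix.sub_mul, e1]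
      abel
    have e3 := congrFun (congrFun e2 k) l
    simp only [Matrix.sub_apply, diagonal_mul, mul_diagonal] at e3
    rw [Matrix.mul_apply, Matrix.mul_apply] at e3
    simp only [mul_comm (T x _ l)]
    rw [← e3]
    ring
  have hTd : ∀ k l, HasFDerivAt (fun x => T x k l)
      (((headInd r k - headInd r l) / (μ x₀ k - μ x₀ l)) • K' k l) x₀ := by
    intro k l
    by_cases hkl : headInd r k = headInd r l
    · -- within a block, the entry is constant up to the square of the increment
      have hq : HasFDerivAt (fun x => ∑ j, (T x k j - D k j) * (T x j l - D j l))
          (0 : E →L[ℝ] ℝ) x₀ := by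
        have hO2 : (fun x => ∑ j, (T x k j - D k j) * (T x j l - D j l))
            =O[𝓝 x₀] fun x => ‖x - x₀‖ ^ 2 := by
          refine IsBigO.fun_sum fun j _ => ?_
          simpa [sq] using ((hNO k j).norm_right.mul (hNO j l).norm_right)
        exact hO2.hasFDerivAt one_lt_two
      have hsq : ∀ x, ∑ j, (T x k j - D k j) * (T x j l - D j l)
          = T x k l - headInd r k * T x k l - headInd r k * T x k l + D k l := fun x => by
        have e : (T x - D) * (T x - D) = T x - T x * D - D * T x + D := by
          have hDD : D * D = D := by
            rw [hD, diagonal_mul_diagonal]; simp only [headInd_mul_self]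
          rw [Matrix.sub_mul, Matrix.mul_sub, Matrix.mul_sub, hTidem, hDD]
          abel
        have e' := congrFun (congrFun e k) l
        rw [Matrix.mul_apply] at e'
        simp only [Matrix.sub_apply, Matrix.add_apply] at e'
        rw [e', hD, mul_diagonal, diagonal_mul, ← hkl]
        ring
      simp only [hsq] at hq
      rw [hkl, sub_self, zero_div, zero_smul]
      rw [← hkl] at *
      by_cases hk : k.val < r
      · have : headInd r k = 1 := by simp [headInd, hk]
        simp only [this] at hq
        have h2 := (hq.neg.add_const (D k l))
        rw [neg_zero] at h2
        refine h2.congr_of_eventuallyEq (Eventually.of_forall fun x => ?_)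
        simp
      · have : headInd r k = 0 := by simp [headInd, hk]
        simp only [this] at hq
        have h2 := hq.sub_const (D k l)
        refine h2.congr_of_eventuallyEq (Eventually.of_forall fun x => ?_)
        simp
    · have hne : μ x₀ k - μ x₀ l ≠ 0 := by
        unfold headInd at hkl
        split_ifs at hkl with h1 h2 h2
        · exact absurd rfl hkl
        · have := hhead k h1; have := htail l (not_lt.1 h2)
          intro h0; linarith
        · have := hhead l h2; have := htail k (not_lt.1 h1)
          intro h0; linarith
        · exact absurd rfl hkl
      have h1 := (HasFDerivAt.fun_sum (u := Finset.univ) fun j _ =>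
        (hK' j l).mul_of_continuousAt_of_eq_zero (hTcont k j) (hK0 j l)).sub
        (HasFDerivAt.fun_sum (u := Finset.univ) fun j _ =>
        (hK' k j).mul_of_continuousAt_of_eq_zero (hTcont j l) (hK0 k j))
      have h2 := h1.const_mul (μ x₀ k - μ x₀ l)⁻¹
      refine (h2.congr_of_eventuallyEq (Eventually.of_forall fun x => ?_)).congr_fderiv ?_
      · simp only [Pi.sub_apply]
        rw [← hcomm, inv_mul_cancel_left₀ hne]
      · ext H
        simp only [hT0, hD, diagonal_apply, ite_smul, zero_smul]
        simp
        ring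
  -- return to the standard basis
  have hback : ∀ x, headProj (U x) r = V * T x * Vᵀ := fun x => by
    calc headProj (U x) r = (V * Vᵀ) * headProj (U x) r * (V * Vᵀ) := by simp [hU']
      _ = _ := by simp only [hT, Matrix.mul_assoc]
  have hTm : HasMatDeriv T (fun H => of fun k l =>
      (headInd r k - headInd r l) / (μ x₀ k - μ x₀ l) * (Vᵀ * A' H * V) k l) x₀ :=
    fun k l => ⟨_, hTd k l, fun H => by simp [hK'']⟩
  simp only [hback]
  exact (hTm.const_mul V).mul_const Vᵀ

/-- The sum of the leading eigenvalues is differentiable wherever there is a gap. -/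
theorem exists_hasFDerivAt_headSum {E : Type*} [NormedAddCommGroup E] [NormedSpace ℝ E]
    {q r : ℕ} (hr : r ≤ q) {A U : E → Matrix (Fin q) (Fin q) ℝ} {μ : E → Fin q → ℝ}
    (h : ∀ x, IsEigenDecomp (A x) (U x) (μ x)) {x₀ : E} {A' : E → Matrix (Fin q) (Fin q) ℝ}
    (hA : HasMatDeriv A A' x₀) {c γ : ℝ} (hγ : 0 < γ)
    (hhead : ∀ k : Fin q, k.val < r → c + γ ≤ μ x₀ k)
    (htail : ∀ l : Fin q, r ≤ l.val → μ x₀ l ≤ c) :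
    ∃ g' : E →L[ℝ] ℝ, HasFDerivAt (fun x => headSum (μ x) r) g' x₀ ∧
      ∀ H, g' H = trace (A' H * headProj (U x₀) r) := by
  set L : Matrix (Fin q) (Fin q) ℝ → ℝ := fun B => trace (B * headProj (U x₀) r) with hL
  choose d hd hd' using (hA.sub_const (A x₀)).mul_const (headProj (U x₀) r)
  have h1 : HasFDerivAt (fun x => L (A x - A x₀)) (∑ i, d i i) x₀ :=
    HasFDerivAt.fun_sum fun i _ => hd i i
  have h2 : HasFDerivAt (fun x => headSum (μ x) r - headSum (μ x₀) r - L (A x - A x₀))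
      (0 : E →L[ℝ] ℝ) x₀ := by
    have hO2 : (fun x => headSum (μ x) r - headSum (μ x₀) r - L (A x - A x₀))
        =O[𝓝 x₀] fun x => ‖x - x₀‖ ^ 2 := by
      refine (IsBigO.of_bound (2 / γ) (Eventually.of_forall fun x => ?_)).trans
        (hA.isBigO_sub.norm_norm.pow 2)
      rw [Real.norm_eq_abs, norm_pow, norm_norm]
      exact (h x₀).abs_headSum_sub_sub_le hr (h x) hγ hhead htail
    exact hO2.hasFDerivAt one_lt_two
  refine ⟨∑ i, d i i, ?_, fun H => by simp [hd', trace]⟩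
  have h3 := (h1.add h2).add_const (headSum (μ x₀) r)
  rw [add_zero] at h3
  refine h3.congr_of_eventuallyEq (Eventually.of_forall fun x => ?_)
  simp only [Pi.add_apply]
  ring

end Derivative

/-! ### The hat matrix, completed singular bases and the trace of the derivative -/

theorem Fin.sum_univ_eq_sum_castLE_add {k q : ℕ} (hk : k ≤ q) (G : Fin q → ℝ) (c : ℝ)
    (hG : ∀ l : Fin q, k ≤ l.val → G l = c) :
    ∑ l, G l = ∑ i : Fin k, G (Fin.castLE hk i) + ((q : ℝ) - k) * c := by
  obtain ⟨m, rfl⟩ := Nat.exists_eq_add_of_le hk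
  rw [Fin.sum_univ_add]
  congr 1
  rw [Finset.sum_congr rfl fun i _ => hG (Fin.natAdd k i) (by simp)]
  simp

/-- The hat matrix `X (Xᵀ X)⁺ Xᵀ` is `W Wᵀ` for an orthonormal basis `W` of the column space. -/
theorem exists_hat_eq_mul_transpose {n p : ℕ} (X : Matrix (Fin n) (Fin p) ℝ) :
    ∃ W : Matrix (Fin n) (Fin X.rank) ℝ, Wᵀ * W = 1 ∧ X * gramPinv X * Xᵀ = W * Wᵀ := by
  obtain ⟨T⟩ := nonempty_thinSVD X X.rank le_rfl (by simpa using X.rank_le_height)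
    (by simpa using X.rank_le_width)
  have hd : ∀ i, T.d i ≠ 0 := by
    have h1 : X.rank ≤ (diagonal T.d).rank := by
      conv_lhs => rw [T.eq_mul]
      exact (rank_mul_le_left _ _).trans (rank_mul_le_right _ _)
    rw [rank_diagonal] at h1
    intro i hi
    have h2 := Fintype.card_subtype_lt (p := fun j => T.d j ≠ 0) (x := i) (by simpa using hi)
    rw [Fintype.card_fin] at h2
    omega
  set D := diagonal T.d with hD
  set D' : Matrix (Fin X.rank) (Fin X.rank) ℝ := diagonal fun i => (T.d i)⁻¹ with hD'
  have hDD' : D * D' = 1 := by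
    rw [hD, hD', diagonal_mul_diagonal, ← diagonal_one]
    congr 1; funext i; exact mul_inv_cancel₀ (hd i)
  have hD'D : D' * D = 1 := mul_eq_one_comm.mp hDD'
  have hW := T.orthonormal_W
  have hV := T.orthonormal_V
  have hX : X = T.W * D * T.Vᵀ := T.eq_mul
  have hXt : Xᵀ = T.V * D * T.Wᵀ := by
    refine (congrArg transpose hX).trans ?_
    simp [Matrix.transpose_mul, Matrix.mul_assoc, hD]
  have hXX : Xᵀ * X = T.V * (D * D) * T.Vᵀ := by
    rw [hXt]
    refine (congrArg (T.V * D * T.Wᵀ * ·) hX).trans ?_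
    calc _ = T.V * D * (T.Wᵀ * T.W) * D * T.Vᵀ := by simp only [Matrix.mul_assoc]
      _ = _ := by rw [hW]; simp only [Matrix.mul_assoc, Matrix.one_mul]
  have hG := (Classical.choose_spec (exists_isMoorePenrose_gram X)).mul_mul
  change Xᵀ * X * gramPinv X * (Xᵀ * X) = Xᵀ * X at hG
  set N := T.Vᵀ * gramPinv X * T.V with hN
  have h1 : D * D * N * (D * D) = D * D := by
    calc D * D * N * (D * D)
        = (T.Vᵀ * T.V) * (D * D) * N * (D * D) * (T.Vᵀ * T.V) := by rw [hV]; simp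
      _ = T.Vᵀ * (T.V * (D * D) * T.Vᵀ * gramPinv X * (T.V * (D * D) * T.Vᵀ)) * T.V := by
          simp only [hN, Matrix.mul_assoc]
      _ = (T.Vᵀ * T.V) * (D * D) * (T.Vᵀ * T.V) := by
          rw [← hXX, hG, hXX]; simp only [Matrix.mul_assoc]
      _ = D * D := by rw [hV]; simp
  have h2 : D * N * D = 1 := by
    calc D * N * D = (D' * D) * D * N * D * (D * D') := by rw [hD'D, hDD']; simp
      _ = D' * (D * D * N * (D * D)) * D' := by simp only [Matrix.mul_assoc]
      _ = (D' * D) * (D * D') := by rw [h1]; simp only [Matrix.mul_assoc]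
      _ = 1 := by rw [hD'D, hDD', Matrix.one_mul]
  refine ⟨T.W, hW, ?_⟩
  rw [hXt]
  refine (congrArg (· * gramPinv X * (T.V * D * T.Wᵀ)) hX).trans ?_
  calc _ = T.W * (D * N * D) * T.Wᵀ := by simp only [hN, Matrix.mul_assoc]
    _ = T.W * T.Wᵀ := by rw [h2, Matrix.mul_one]

/-- A spectral decomposition of `Bᵀ B` extending a thin singular value decomposition of `B`: the
right singular vectors are completed to an orthonormal basis, the eigenvalues are the squared
singular values followed by zeros. -/
structure IsFullDecomp {n q k : ℕ} {B : Matrix (Fin n) (Fin q) ℝ} (T : ThinSVD B k) (hk : k ≤ q)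
    (U : Matrix (Fin q) (Fin q) ℝ) (μ : Fin q → ℝ) : Prop where
  eigen : IsEigenDecomp (Bᵀ * B) U μ
  head : ∀ i, μ (Fin.castLE hk i) = T.d i ^ 2
  tail : ∀ l : Fin q, k ≤ l.val → μ l = 0
  col : ∀ j i, U j (Fin.castLE hk i) = T.V j i

theorem ThinSVD.exists_isFullDecomp {n q k : ℕ} {B : Matrix (Fin n) (Fin q) ℝ} (T : ThinSVD B k)
    (hk : k ≤ q) : ∃ U μ, IsFullDecomp T hk U μ := by
  classical
  let v : Fin q → EuclideanSpace ℝ (Fin q) := fun b =>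
    if h : b.val < k then WithLp.toLp 2 (fun a => T.V a ⟨b, h⟩) else 0
  let s : Set (Fin q) := {b | b.val < k}
  have hVe : ∀ i j, ∑ a, T.V a i * T.V a j = if i = j then 1 else 0 := by
    intro i j
    have := congrFun (congrFun T.orthonormal_V i) j
    simpa [Matrix.mul_apply, one_apply] using this
  have hv : Orthonormal ℝ (s.domRestrict v) := by
    rw [orthonormal_iff_ite]
    rintro ⟨b, hb⟩ ⟨c, hc⟩
    have hb' : b.val < k := hb
    have hc' : c.val < k := hc
    change inner ℝ (v b) (v c) = _
    have hin : inner ℝ (v b) (v c) = ∑ a, T.V a ⟨c, hc'⟩ * T.V a ⟨b, hb'⟩ := by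
      simp only [v, dif_pos hb', dif_pos hc', PiLp.inner_apply]
      rfl
    rw [hin, hVe]
    simp [Fin.ext_iff, eq_comm]
  obtain ⟨b, hb⟩ := hv.exists_orthonormalBasis_extension_of_card_eq (by simp)
  set U : Matrix (Fin q) (Fin q) ℝ := of fun a i => b i a with hU
  have hcol : ∀ j i, U j (Fin.castLE hk i) = T.V j i := by
    intro j i
    have hmem : Fin.castLE hk i ∈ s := i.2
    simp only [hU, of_apply]
    rw [hb _ hmem]
    simp [v]
  have hUU : Uᵀ * U = 1 := by
    ext i j
    have := orthonormal_iff_ite.mp b.orthonormal j i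
    simp only [PiLp.inner_apply] at this
    simpa [hU, Matrix.mul_apply, one_apply, eq_comm] using this
  set μ : Fin q → ℝ := fun l => if h : l.val < k then T.d ⟨l, h⟩ ^ 2 else 0 with hμ
  refine ⟨U, μ, ⟨hUU, ?_, ?_⟩, fun i => by simp [hμ], fun l hl => by simp [hμ, not_lt.2 hl], hcol⟩
  · intro i j hij
    simp only [hμ]
    split_ifs with h1 h2 h2
    · exact pow_le_pow_left₀ (T.nonneg_d _) (T.antitone_d (by simpa using hij)) 2
    · exact absurd (lt_of_le_of_lt (Fin.le_def.1 hij) h1) h2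
    · positivity
    · exact le_rfl
  · have hBB : Bᵀ * B = T.V * diagonal (fun i => T.d i ^ 2) * T.Vᵀ := by
      have hBt : Bᵀ = T.V * diagonal T.d * T.Wᵀ := by
        refine (congrArg transpose T.eq_mul).trans ?_
        simp [Matrix.transpose_mul, Matrix.mul_assoc]
      rw [hBt]
      refine (congrArg (T.V * diagonal T.d * T.Wᵀ * ·) T.eq_mul).trans ?_
      calc _ = T.V * (diagonal T.d * (T.Wᵀ * T.W) * diagonal T.d) * T.Vᵀ := by
            simp only [Matrix.mul_assoc]
        _ = _ := by rw [T.orthonormal_W, Matrix.mul_one, diagonal_mul_diagonal]; simp only [sq]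
    rw [hBB]
    ext a c
    rw [Matrix.mul_apply, Matrix.mul_apply]
    simp only [Matrix.mul_diagonal, transpose_apply]
    rw [Fin.sum_univ_eq_sum_castLE_add hk _ 0 fun l hl => by simp [hμ, not_lt.2 hl]]
    simp [hcol, hμ]

namespace IsFullDecomp

variable {n q k : ℕ} {B : Matrix (Fin n) (Fin q) ℝ} {T : ThinSVD B k} {hk : k ≤ q}
  {U : Matrix (Fin q) (Fin q) ℝ} {μ : Fin q → ℝ}

theorem headProj_eq (h : IsFullDecomp T hk U μ) {r : ℕ} (hr : r ≤ k) :
    headProj U r = ∑ i : Fin k with i.val < r, vecMulVec (fun j => T.V j i) (fun j => T.V j i) := by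
  ext a c
  rw [headProj, Matrix.mul_apply, Matrix.sum_apply]
  simp only [Matrix.mul_diagonal, transpose_apply, vecMulVec_apply]
  rw [Fin.sum_univ_eq_sum_castLE_add hk _ 0 fun l hl => by
    simp [headInd, not_lt.2 (hr.trans hl)], Finset.sum_filter]
  simp [h.col, headInd]

/-- At a point with distinct positive singular values there is a gap after every index up to the
number of singular values. -/
theorem exists_gap (h : IsFullDecomp T hk U μ) (hd : StrictAnti T.d) (hpos : ∀ i, 0 < T.d i)
    {r : ℕ} (hr : r ≤ k) : ∃ c γ : ℝ, 0 < γ ∧ (∀ i : Fin q, i.val < r → c + γ ≤ μ i) ∧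
      ∀ l : Fin q, r ≤ l.val → μ l ≤ c := by
  have hanti := h.eigen.anti
  rcases Nat.eq_zero_or_pos r with rfl | hr0
  · rcases Nat.eq_zero_or_pos q with rfl | hq
    · exact ⟨0, 1, one_pos, fun i => i.elim0, fun i => i.elim0⟩
    · exact ⟨μ ⟨0, hq⟩, 1, one_pos, fun i hi => by omega,
        fun l _ => hanti (Fin.mk_le_of_le_val (Nat.zero_le _))⟩
  · have hhead : ∀ i : Fin q, i.val < r → μ ⟨r - 1, by omega⟩ ≤ μ i := fun i hi =>
      hanti (Fin.le_def.2 (by simp; omega))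
    have e1 : μ ⟨r - 1, by omega⟩ = T.d ⟨r - 1, by omega⟩ ^ 2 := h.head ⟨r - 1, by omega⟩
    rcases hr.lt_or_eq with hlt | rfl
    · have e2 : μ ⟨r, by omega⟩ = T.d ⟨r, hlt⟩ ^ 2 := h.head ⟨r, hlt⟩
      have hlt' : T.d ⟨r, hlt⟩ < T.d ⟨r - 1, by omega⟩ := hd (Fin.lt_def.2 (by simp; omega))
      refine ⟨μ ⟨r, by omega⟩, μ ⟨r - 1, by omega⟩ - μ ⟨r, by omega⟩, ?_, fun i hi => ?_,
        fun l hl => hanti (Fin.mk_le_of_le_val hl)⟩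
      · rw [e1, e2, sub_pos]
        exact pow_lt_pow_left₀ hlt' (hpos _).le two_ne_zero
      · linarith [hhead i hi]
    · refine ⟨0, μ ⟨r - 1, by omega⟩, ?_, fun i hi => ?_, fun l hl => (h.tail l hl).le⟩
      · rw [e1]; exact pow_pos (hpos _) 2
      · linarith [hhead i hi]

end IsFullDecomp

/-- The derivative in the direction `H` of `Y ↦ B Q`, where `B = P Y` and `Q` is the projection onto
the leading `r` eigenvectors of `Bᵀ B = U diag(μ) Uᵀ`. Where `μ k = μ l` the quotient is `0`; if there is
a gap after the `r`-th eigenvalue, `k` and `l` are then on the same side of it and `0` is the right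
value. -/
noncomputable def rrDeriv {n q : ℕ} (P : Matrix (Fin n) (Fin n) ℝ) (B : Matrix (Fin n) (Fin q) ℝ)
    (U : Matrix (Fin q) (Fin q) ℝ) (μ : Fin q → ℝ) (r : ℕ) (H : Matrix (Fin n) (Fin q) ℝ) :
    Matrix (Fin n) (Fin q) ℝ :=
  P * H * headProj U r + B * (U * (of fun k l => (headInd r k - headInd r l) / (μ k - μ l) *
    (Uᵀ * ((P * H)ᵀ * B + Bᵀ * (P * H)) * U) k l) * Uᵀ)

/-- The trace of `rrDeriv`. -/
theorem sum_rrDeriv_single_apply {n q r : ℕ} {P : Matrix (Fin n) (Fin n) ℝ}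
    {B : Matrix (Fin n) (Fin q) ℝ} {U : Matrix (Fin q) (Fin q) ℝ} {μ : Fin q → ℝ}
    (hP : Pᵀ = P) (hPB : P * B = B) (h : IsEigenDecomp (Bᵀ * B) U μ) :
    ∑ i, ∑ j, rrDeriv P B U μ r (Matrix.single i j 1) i j
      = trace P * trace (headProj U r)
        + ∑ k, ∑ l, (headInd r k - headInd r l) / (μ k - μ l) * μ k := by
  set C := B * U with hC
  set R : Fin q → Fin q → ℝ := fun k l => (headInd r k - headInd r l) / (μ k - μ l) with hR
  have hCC : ∀ k l, ∑ i, C i k * C i l = if k = l then μ k else 0 := by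
    have : Cᵀ * C = diagonal μ := by
      calc Cᵀ * C = Uᵀ * (Bᵀ * B) * U := by simp only [hC, transpose_mul, Matrix.mul_assoc]
        _ = (Uᵀ * U) * diagonal μ * (Uᵀ * U) := by
            rw [h.eq_mul]; simp only [Matrix.mul_assoc]
        _ = diagonal μ := by rw [h.orth]; simp
    intro k l
    have := congrFun (congrFun this k) l
    simpa [Matrix.mul_apply, diagonal_apply] using this
  have hUU : ∀ k l, ∑ j, U j k * U j l = if k = l then 1 else 0 := by
    intro k l
    have := congrFun (congrFun h.orth k) l
    simpa [Matrix.mul_apply, one_apply] using this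
  have hBP : Bᵀ * P = Bᵀ := by
    conv_rhs => rw [← hPB]
    rw [transpose_mul, hP]
  let E : Fin n → Fin q → Matrix (Fin n) (Fin q) ℝ := fun i j => Matrix.single i j 1
  have hinner : ∀ i j k l, (Uᵀ * ((P * E i j)ᵀ * B + Bᵀ * (P * E i j)) * U) k l
      = U j k * C i l + C i k * U j l := by
    intro i j k l
    have e : Uᵀ * ((P * E i j)ᵀ * B + Bᵀ * (P * E i j)) * U
        = (E i j * U)ᵀ * C + Cᵀ * (E i j * U) := by
      rw [transpose_mul P, hP, Matrix.mul_assoc _ P B, hPB, ← Matrix.mul_assoc Bᵀ P, hBP]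
      simp only [hC, transpose_mul, Matrix.mul_add, Matrix.add_mul, Matrix.mul_assoc]
    have hEU : ∀ a b, (E i j * U) a b = if a = i then U j b else 0 := by
      intro a b
      simp only [E]
      by_cases ha : a = i
      · subst ha; simp
      · simp [ha, Matrix.single_mul_apply_of_ne (h := ha)]
    rw [e, Matrix.add_apply, Matrix.mul_apply, Matrix.mul_apply]
    simp [hEU]
  have hfirst : ∀ i j, (P * E i j * headProj U r) i j = P i i * headProj U r j j := by
    intro i j
    simp only [E]
    rw [Matrix.mul_apply]
    rw [Finset.sum_eq_single j]
    · simp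
    · intro b _ hb
      rw [Matrix.mul_single_apply_of_ne (hbj := hb)]
      simp
    · simp
  have hsecond : ∀ i j, (B * (U * (of fun k l =>
        R k l * (Uᵀ * ((P * E i j)ᵀ * B + Bᵀ * (P * E i j)) * U) k l) * Uᵀ)) i j
      = ∑ k, ∑ l, R k l * ((C i k * C i l) * (U j k * U j l) + C i k * C i k * (U j l * U j l)) := by
    intro i j
    rw [← Matrix.mul_assoc, ← Matrix.mul_assoc, ← hC, Matrix.mul_apply, Finset.sum_comm]
    simp only [Matrix.mul_apply (M := C), Finset.sum_mul, of_apply, transpose_apply, hinner]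
    rw [Finset.sum_comm]
    refine Finset.sum_comm.trans (Finset.sum_congr rfl fun k _ => Finset.sum_congr rfl fun l _ => ?_)
    ring
  have hsplit : ∀ i j, rrDeriv P B U μ r (Matrix.single i j 1) i j = (P * E i j * headProj U r) i j
      + (B * (U * (of fun k l =>
        R k l * (Uᵀ * ((P * E i j)ᵀ * B + Bᵀ * (P * E i j)) * U) k l) * Uᵀ)) i j := fun i j => rfl
  simp only [hsplit, Finset.sum_add_distrib, hfirst, hsecond]
  congr 1
  · simp [trace, Finset.sum_mul_sum]
  · have swap : ∀ F : Fin n → Fin q → Fin q → Fin q → ℝ,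
        ∑ i, ∑ j, ∑ k, ∑ l, F i j k l = ∑ k, ∑ l, ∑ i, ∑ j, F i j k l := by
      intro F
      calc ∑ i, ∑ j, ∑ k, ∑ l, F i j k l = ∑ i, ∑ k, ∑ l, ∑ j, F i j k l :=
            Finset.sum_congr rfl fun i _ => Finset.sum_comm.trans
              (Finset.sum_congr rfl fun k _ => Finset.sum_comm)
        _ = ∑ k, ∑ l, ∑ i, ∑ j, F i j k l := Finset.sum_comm.trans
              (Finset.sum_congr rfl fun k _ => Finset.sum_comm)
    rw [swap]
    refine Finset.sum_congr rfl fun k _ => Finset.sum_congr rfl fun l _ => ?_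
    have e : ∑ i, ∑ j, R k l * ((C i k * C i l) * (U j k * U j l) + C i k * C i k * (U j l * U j l))
        = R k l * ((∑ i, C i k * C i l) * (∑ j, U j k * U j l)
          + (∑ i, C i k * C i k) * ∑ j, U j l * U j l) := by
      rw [Finset.sum_mul_sum, Finset.sum_mul_sum, ← Finset.sum_add_distrib, Finset.mul_sum]
      refine Finset.sum_congr rfl fun i _ => ?_
      rw [← Finset.sum_add_distrib, Finset.mul_sum]
    rw [e, hCC, hCC, hUU, hUU]
    by_cases hkl : k = l
    · subst hkl; simp [hR]
    · simp [hkl, hR]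

/-- Symmetrisation of the double sum produced by `sum_rrDeriv_single_apply`. -/
theorem sum_divided_difference_mul {q : ℕ} (r : ℕ) (μ : Fin q → ℝ) :
    ∑ k, ∑ l, (headInd r k - headInd r l) / (μ k - μ l) * μ k
      = ∑ k, ∑ l, headInd r k * (1 - headInd r l) * ((μ k + μ l) / (μ k - μ l)) := by
  have h1 : ∀ k l, (headInd r k - headInd r l) / (μ k - μ l) * μ k
      = headInd r k * (1 - headInd r l) * (μ k / (μ k - μ l))
        + headInd r l * (1 - headInd r k) * (μ k / (μ l - μ k)) := fun k l => by
    rw [← neg_sub (μ k) (μ l), div_neg]; ring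
  simp only [h1, Finset.sum_add_distrib]
  rw [Finset.sum_comm (f := fun k l => headInd r l * (1 - headInd r k) * (μ k / (μ l - μ k)))]
  simp only [← Finset.sum_add_distrib]
  refine Finset.sum_congr rfl fun k _ => Finset.sum_congr rfl fun l _ => ?_
  ring

/-- Each of the `q - k` zero eigenvalues pairs with each leading one to contribute `1`, which turns
`rx * r` into `max rx q * r` when `r < k = min rx q`, and into `rx * q` when `r = k`. -/
theorem IsFullDecomp.dfHat_eq {n q rx : ℕ} {B : Matrix (Fin n) (Fin q) ℝ}
    {T : ThinSVD B (min rx q)} {U : Matrix (Fin q) (Fin q) ℝ} {μ : Fin q → ℝ}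
    (h : IsFullDecomp T (min_le_right _ _) U μ) (hpos : ∀ i, 0 < T.d i) {r : ℕ}
    (hr : r ≤ min rx q) :
    (rx : ℝ) * r + ∑ k, ∑ l, (headInd r k - headInd r l) / (μ k - μ l) * μ k
      = dfHat rx q r T.d := by
  rw [sum_divided_difference_mul]
  have hl : ∀ k : Fin q, ∑ l, headInd r k * (1 - headInd r l) * ((μ k + μ l) / (μ k - μ l))
      = ∑ i : Fin (min rx q), headInd r k * (1 - headInd r i) *
          ((μ k + T.d i ^ 2) / (μ k - T.d i ^ 2)) + ((q : ℝ) - (min rx q : ℕ)) * headInd r k := by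
    intro k
    rw [Fin.sum_univ_eq_sum_castLE_add (min_le_right rx q) _ (headInd r k)]
    · simp only [h.head]
      rfl
    · intro l hl
      rw [h.tail l hl]
      by_cases hk : k.val < r
      · have hμ : μ k ≠ 0 := by
          have := h.head ⟨k.val, by omega⟩
          change μ k = _ at this
          rw [this]
          exact (pow_pos (hpos _) 2).ne'
        have : ¬ l.val < r := by omega
        simp [headInd, this, hμ]
      · simp [headInd, hk]
  simp only [hl, Finset.sum_add_distrib, ← Finset.mul_sum]
  rw [sum_headInd (hr.trans (min_le_right _ _)),
    Fin.sum_univ_eq_sum_castLE_add (min_le_right rx q) _ 0 (fun k hk => by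
      simp [headInd, not_lt.2 (hr.trans hk)])]
  simp only [h.head, mul_zero, add_zero]
  have hmm : ((min rx q : ℕ) : ℝ) + (max rx q : ℕ) = rx + q := by
    exact_mod_cast min_add_max rx q
  unfold dfHat
  split_ifs with hlt
  · have : ∀ k : Fin (min rx q), ∑ i : Fin (min rx q), headInd r (Fin.castLE (min_le_right rx q) k)
        * (1 - headInd r i) * ((T.d k ^ 2 + T.d i ^ 2) / (T.d k ^ 2 - T.d i ^ 2))
        = if k.val < r then ∑ l : Fin (min rx q) with r ≤ l.val,
          (T.d k ^ 2 + T.d l ^ 2) / (T.d k ^ 2 - T.d l ^ 2) else 0 := by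
      intro k
      rw [Finset.sum_filter]
      split_ifs with hk
      · refine Finset.sum_congr rfl fun l _ => ?_
        by_cases hl : l.val < r
        · simp [headInd, hl, not_le.2 hl]
        · simp [headInd, hl, hk, not_lt.1 hl]
      · simp [headInd, hk]
    simp only [this]
    rw [← Finset.sum_filter]
    linear_combination (-(r : ℝ)) * hmm
  · have hre : r = min rx q := le_antisymm hr (not_lt.1 hlt)
    have : ∀ k i : Fin (min rx q), headInd r (Fin.castLE (min_le_right rx q) k)
        * (1 - headInd r i) * ((T.d k ^ 2 + T.d i ^ 2) / (T.d k ^ 2 - T.d i ^ 2)) = 0 := by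
      intro k i
      have : i.val < r := by omega
      simp [headInd, this]
    simp only [this, Finset.sum_const_zero]
    rw [← hre]
    rcases min_choice rx q with hm | hm <;> rw [hm] at hre <;> rw [hre] <;> ring

/-- Each summand `(d_k² + d_l²) / (d_k² - d_l²)` is at least one. -/
theorem le_dfHat {rx q r : ℕ} {d : Fin (min rx q) → ℝ} (hd : StrictAnti d) (hpos : ∀ i, 0 < d i)
    (hr : r ≤ min rx q) : ((rx : ℝ) + q - r) * r ≤ dfHat rx q r d := by
  have hmm : ((min rx q : ℕ) : ℝ) + (max rx q : ℕ) = rx + q := by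
    exact_mod_cast min_add_max rx q
  unfold dfHat
  split_ifs with hlt
  · have h1 : ∀ k ∈ (Finset.univ.filter fun k : Fin (min rx q) => k.val < r),
        ((min rx q : ℕ) : ℝ) - r ≤ ∑ l : Fin (min rx q) with r ≤ l.val,
          (d k ^ 2 + d l ^ 2) / (d k ^ 2 - d l ^ 2) := by
      intro k hk
      have hk' : k.val < r := by simpa using hk
      have hcard : (((Finset.univ : Finset (Fin (min rx q))).filter fun l => r ≤ l.val).card : ℝ)
          = ((min rx q : ℕ) : ℝ) - r := by
        have : ((Finset.univ : Finset (Fin (min rx q))).filter fun l => r ≤ l.val).card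
            = min rx q - r := by
          have := Finset.card_filter_add_card_filter_not (s := (Finset.univ : Finset (Fin (min rx q))))
            (fun l => l.val < r)
          rw [Fin.card_filter_val_lt, Finset.card_fin] at this
          simp only [not_lt] at this
          omega
        rw [this, Nat.cast_sub hr]
      rw [← hcard, ← nsmul_one]
      refine Finset.card_nsmul_le_sum _ _ _ fun l hl => ?_
      have hl' : r ≤ l.val := by simpa using hl
      have hlt' : d l < d k := hd (Fin.lt_def.2 (by omega))
      have : 0 < d k ^ 2 - d l ^ 2 := sub_pos.2 (pow_lt_pow_left₀ hlt' (hpos _).le two_ne_zero)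
      rw [le_div_iff₀ this]
      nlinarith [sq_nonneg (d l)]
    have h2 := Finset.card_nsmul_le_sum _ _ _ h1
    have hc : ((Finset.univ : Finset (Fin (min rx q))).filter fun k => k.val < r).card = r := by
      rw [Fin.card_filter_val_lt]; omega
    rw [hc, nsmul_eq_mul] at h2
    have : ((rx : ℝ) + q - r) * r = (max rx q : ℕ) * (r : ℝ) + r * (((min rx q : ℕ) : ℝ) - r) := by
      linear_combination (-(r : ℝ)) * hmm
    linarith
  · have hre : r = min rx q := le_antisymm hr (not_lt.1 hlt)
    rcases min_choice rx q with hm | hm <;> rw [hm] at hre <;> rw [hre] <;> apply le_of_eq <;> ring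

/-- The single term at the boundary of the leading block is a lower bound. -/
theorem boundary_term_le_dfHat {rx q r : ℕ} {d : Fin (min rx q) → ℝ} (hd : StrictAnti d)
    (hpos : ∀ i, 0 < d i) (hr : r < min rx q) {k : Fin (min rx q)} (hk : k.val < r) :
    d k ^ 2 / (d k ^ 2 - d ⟨r, hr⟩ ^ 2) ≤ dfHat rx q r d := by
  have hterm : ∀ k l : Fin (min rx q), k.val < r → r ≤ l.val →
      0 < d k ^ 2 - d l ^ 2 := fun k l hk hl =>
    sub_pos.2 (pow_lt_pow_left₀ (hd (Fin.lt_def.2 (by omega))) (hpos _).le two_ne_zero)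
  have hnn : ∀ k l : Fin (min rx q), k.val < r → r ≤ l.val →
      0 ≤ (d k ^ 2 + d l ^ 2) / (d k ^ 2 - d l ^ 2) := fun k l hk hl =>
    div_nonneg (by positivity) (hterm k l hk hl).le
  rw [dfHat, if_pos hr]
  have h0 : (0 : ℝ) ≤ (max rx q : ℕ) * (r : ℝ) := by positivity
  have h1 : d k ^ 2 / (d k ^ 2 - d ⟨r, hr⟩ ^ 2)
      ≤ (d k ^ 2 + d ⟨r, hr⟩ ^ 2) / (d k ^ 2 - d ⟨r, hr⟩ ^ 2) :=
    div_le_div_of_nonneg_right (by linarith [sq_nonneg (d ⟨r, hr⟩)]) (hterm k _ hk le_rfl).le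
  have h2 := Finset.single_le_sum (f := fun l => (d k ^ 2 + d l ^ 2) / (d k ^ 2 - d l ^ 2))
    (s := Finset.univ.filter fun l : Fin (min rx q) => r ≤ l.val)
    (fun l hl => hnn k l hk (by simpa using hl)) (a := ⟨r, hr⟩) (by simp)
  have h3 := Finset.single_le_sum
    (f := fun k => ∑ l : Fin (min rx q) with r ≤ l.val, (d k ^ 2 + d l ^ 2) / (d k ^ 2 - d l ^ 2))
    (s := Finset.univ.filter fun k : Fin (min rx q) => k.val < r)
    (fun k hk => Finset.sum_nonneg fun l hl => hnn k l (by simpa using hk) (by simpa using hl))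
    (a := k) (by simpa using hk)
  linarith

/-! ### The reduced-rank fit: derivative and divergence -/

/-- A choice of an orthonormal basis completing the right singular vectors. -/
noncomputable def ThinSVD.basis {n q k : ℕ} {B : Matrix (Fin n) (Fin q) ℝ} (T : ThinSVD B k)
    (hk : k ≤ q) : Matrix (Fin q) (Fin q) ℝ :=
  Classical.choose (T.exists_isFullDecomp hk)

/-- The eigenvalues of `Bᵀ B`: the squared singular values followed by zeros. -/
noncomputable def ThinSVD.eig {n q k : ℕ} {B : Matrix (Fin n) (Fin q) ℝ} (T : ThinSVD B k)
    (hk : k ≤ q) : Fin q → ℝ :=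
  Classical.choose (Classical.choose_spec (T.exists_isFullDecomp hk))

theorem ThinSVD.isFullDecomp {n q k : ℕ} {B : Matrix (Fin n) (Fin q) ℝ} (T : ThinSVD B k)
    (hk : k ≤ q) : IsFullDecomp T hk (T.basis hk) (T.eig hk) :=
  Classical.choose_spec (Classical.choose_spec (T.exists_isFullDecomp hk))

section Hat

variable {n p q : ℕ} (X : Matrix (Fin n) (Fin p) ℝ)

theorem transpose_hat : (X * gramPinv X * Xᵀ)ᵀ = X * gramPinv X * Xᵀ := by
  obtain ⟨W, -, h⟩ := exists_hat_eq_mul_transpose X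
  rw [h, transpose_mul, transpose_transpose]

theorem hat_mul_self : X * gramPinv X * Xᵀ * (X * gramPinv X * Xᵀ) = X * gramPinv X * Xᵀ := by
  obtain ⟨W, hW, h⟩ := exists_hat_eq_mul_transpose X
  rw [h]
  calc W * Wᵀ * (W * Wᵀ) = W * (Wᵀ * W) * Wᵀ := by simp only [Matrix.mul_assoc]
    _ = W * Wᵀ := by rw [hW, Matrix.mul_one]

theorem trace_hat : trace (X * gramPinv X * Xᵀ) = X.rank := by
  obtain ⟨W, hW, h⟩ := exists_hat_eq_mul_transpose X
  rw [h, trace_mul_comm, hW, trace_one, Fintype.card_fin]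

theorem hat_mul_lsFit (Y : Matrix (Fin n) (Fin q) ℝ) :
    X * gramPinv X * Xᵀ * lsFit X Y = lsFit X Y := by
  rw [lsFit, ← Matrix.mul_assoc, hat_mul_self]

end Hat

section RankReduced

variable {n p q k r : ℕ} {X : Matrix (Fin n) (Fin p) ℝ}
  {S : ∀ Y : Matrix (Fin n) (Fin q) ℝ, ThinSVD (lsFit X Y) k}

theorem rrFit_eq (hk : k ≤ q) (hr : r ≤ k) (Y : Matrix (Fin n) (Fin q) ℝ) :
    rrFit X S r Y = lsFit X Y * headProj ((S Y).basis hk) r := by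
  rw [rrFit, ((S Y).isFullDecomp hk).headProj_eq hr]

variable {E : Type*} [NormedAddCommGroup E] [NormedSpace ℝ E]
  {mat : E → Matrix (Fin n) (Fin q) ℝ}

theorem hasMatDeriv_lsFit (hmat : ∀ x, HasMatDeriv mat mat x) (x : E) :
    HasMatDeriv (fun y => lsFit X (mat y)) (fun H => lsFit X (mat H)) x :=
  (hmat x).const_mul _

theorem hasMatDeriv_gram_lsFit (hmat : ∀ x, HasMatDeriv mat mat x) (x : E) :
    HasMatDeriv (fun y => (lsFit X (mat y))ᵀ * lsFit X (mat y))
      (fun H => (lsFit X (mat H))ᵀ * lsFit X (mat x) + (lsFit X (mat x))ᵀ * lsFit X (mat H)) x :=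
  (hasMatDeriv_lsFit hmat x).transpose.mul (hasMatDeriv_lsFit hmat x)

/-- The reduced rank fit is differentiable where the singular values are distinct and positive.
The space `E` of parameters is a normed copy of the space of matrices. -/
theorem hasMatDeriv_rrFit (hmat : ∀ x, HasMatDeriv mat mat x) (hk : k ≤ q) (hr : r ≤ k) {x : E}
    (hd : StrictAnti (S (mat x)).d) (hpos : ∀ i, 0 < (S (mat x)).d i) :
    HasMatDeriv (fun y => rrFit X S r (mat y)) (fun H => rrDeriv (X * gramPinv X * Xᵀ)
      (lsFit X (mat x)) ((S (mat x)).basis hk) ((S (mat x)).eig hk) r (mat H)) x := by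
  obtain ⟨c, γ, hγ, h1, h2⟩ := ((S (mat x)).isFullDecomp hk).exists_gap hd hpos hr
  have h := hasMatDeriv_headProj (hr.trans hk)
    (fun y => ((S (mat y)).isFullDecomp hk).eigen) (hasMatDeriv_gram_lsFit hmat x) hγ h1 h2
  simp only [rrFit_eq hk hr]
  exact (hasMatDeriv_lsFit hmat x).mul h

theorem sum_rrDeriv_eq_dfHat {S : ∀ Y : Matrix (Fin n) (Fin q) ℝ, ThinSVD (lsFit X Y) (min X.rank q)}
    (hr : r ≤ min X.rank q) {Y : Matrix (Fin n) (Fin q) ℝ} (hpos : ∀ i, 0 < (S Y).d i) :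
    ∑ i, ∑ j, rrDeriv (X * gramPinv X * Xᵀ) (lsFit X Y) ((S Y).basis (min_le_right _ _))
      ((S Y).eig (min_le_right _ _)) r (Matrix.single i j 1) i j = dfHat X.rank q r (S Y).d := by
  have h := (S Y).isFullDecomp (min_le_right _ _)
  rw [sum_rrDeriv_single_apply (transpose_hat X) (hat_mul_lsFit X Y) h.eigen, trace_hat,
    (isRankProj_headProj (hr.trans (min_le_right _ _)) h.eigen.orth).trace_eq, h.dfHat_eq hpos hr]

theorem differentiableAt_rrFit_and_divergence_eq
    {S : ∀ Y : Matrix (Fin n) (Fin q) ℝ, ThinSVD (lsFit X Y) (min X.rank q)}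
    (hr : r ≤ min X.rank q) {Y : Matrix (Fin n) (Fin q) ℝ} (hd : StrictAnti (S Y).d)
    (hpos : ∀ i, 0 < (S Y).d i) :
    DifferentiableAt ℝ (rrFit X S r) Y ∧ divergence (rrFit X S r) Y = dfHat X.rank q r (S Y).d := by
  -- the sup norm on functions of two variables induces the topology of the space of matrices
  let mat : (Fin n → Fin q → ℝ) → Matrix (Fin n) (Fin q) ℝ := fun x => Matrix.of x
  have hmat : ∀ x, HasMatDeriv mat mat x := fun x i j => by
    have h := hasFDerivAt_pi'.1 (hasFDerivAt_pi'.1 (hasFDerivAt_id (𝕜 := ℝ) x) i) j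
    exact ⟨_, h, fun _ => rfl⟩
  let x : Fin n → Fin q → ℝ := fun i j => Y i j
  choose d h1 h2 using hasMatDeriv_rrFit hmat (min_le_right _ _) hr (x := x) hd hpos
  have h3 : HasFDerivAt (fun y : Fin n → Fin q → ℝ => fun i j => rrFit X S r (Matrix.of y) i j)
      (ContinuousLinearMap.pi fun i => ContinuousLinearMap.pi fun j => d i j) x :=
    hasFDerivAt_pi.2 fun i => hasFDerivAt_pi.2 fun j => h1 i j
  let f' : Matrix (Fin n) (Fin q) ℝ →L[ℝ] Matrix (Fin n) (Fin q) ℝ :=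
    ContinuousLinearMap.pi fun i => ContinuousLinearMap.pi fun j => d i j
  have h4 : HasFDerivAt (rrFit X S r) f' Y := h3
  refine ⟨h4.differentiableAt, ?_⟩
  rw [divergence, h4.fderiv, ← sum_rrDeriv_eq_dfHat hr hpos]
  refine Finset.sum_congr rfl fun i _ => Finset.sum_congr rfl fun j _ => ?_
  exact h2 i j (Matrix.single i j 1)

end RankReduced

/-! ### Gaussian vectors and Stein's identity for compactly supported functions -/

section Stein

open Filter Topology

/-- Fatou: a nonnegative almost everywhere limit of functions with convergent integrals is
integrable. -/
theorem integrable_of_tendsto_of_tendsto_integral {α : Type*} [MeasurableSpace α] {μ : Measure α}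
    {a : ℕ → α → ℝ} {A : α → ℝ} (hint : ∀ N, Integrable (a N) μ) (h0 : ∀ N, 0 ≤ᵐ[μ] a N)
    (hlim : ∀ᵐ x ∂μ, Tendsto (fun N => a N x) atTop (𝓝 (A x))) {L : ℝ}
    (hL : Tendsto (fun N => ∫ x, a N x ∂μ) atTop (𝓝 L)) : Integrable A μ := by
  refine ⟨aestronglyMeasurable_of_tendsto_ae _ (fun N => (hint N).aestronglyMeasurable) hlim, ?_⟩
  have h1 : ∫⁻ x, ‖A x‖ₑ ∂μ ≤ liminf (fun N => ∫⁻ x, ‖a N x‖ₑ ∂μ) atTop := by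
    have : ∫⁻ x, ‖A x‖ₑ ∂μ = ∫⁻ x, liminf (fun N => ‖a N x‖ₑ) atTop ∂μ :=
      lintegral_congr_ae (by filter_upwards [hlim] with x hx using hx.enorm.liminf_eq.symm)
    rw [this]
    exact lintegral_liminf_le' fun N => (hint N).aestronglyMeasurable.enorm
  have h2 : ∀ N, ∫⁻ x, ‖a N x‖ₑ ∂μ = ENNReal.ofReal (∫ x, a N x ∂μ) := fun N => by
    rw [ofReal_integral_eq_lintegral_ofReal (hint N) (h0 N)]
    refine lintegral_congr_ae ?_
    filter_upwards [h0 N] with x hx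
    rw [Real.enorm_eq_ofReal hx]
  simp only [h2] at h1
  have h3 : liminf (fun N => ENNReal.ofReal (∫ x, a N x ∂μ)) atTop = ENNReal.ofReal L :=
    ((ENNReal.continuous_ofReal.tendsto L).comp hL).liminf_eq
  exact lt_of_le_of_lt (h1.trans_eq h3) ENNReal.ofReal_lt_top

variable {ι : Type*} [Fintype ι] (m : ι → ℝ) (v : ℝ≥0)

/-- The law of a vector of independent Gaussian variables with means `m i` and variance `v`. -/
noncomputable def gaussianVector : Measure (ι → ℝ) := Measure.pi fun i => gaussianReal (m i) v

instance : IsProbabilityMeasure (gaussianVector m v) := by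
  unfold gaussianVector; infer_instance

/-- The joint density of independent Gaussian variables with means `m i` and variance `v`. -/
noncomputable def gaussianVectorPDF (x : ι → ℝ) : ℝ := ∏ i, gaussianPDFReal (m i) v (x i)

variable {v}

theorem gaussianVectorPDF_nonneg (x : ι → ℝ) : 0 ≤ gaussianVectorPDF m v x :=
  Finset.prod_nonneg fun _ _ => gaussianPDFReal_nonneg _ _ _

theorem contDiff_gaussianVectorPDF {n : ℕ∞} : ContDiff ℝ n (gaussianVectorPDF m v) := by
  unfold gaussianVectorPDF gaussianPDFReal
  fun_prop

theorem gaussianVector_eq_withDensity (hv : v ≠ 0) : gaussianVector m v =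
    (volume : Measure (ι → ℝ)).withDensity fun x => ENNReal.ofReal (gaussianVectorPDF m v x) := by
  refine (Measure.pi_eq fun s hs => ?_)
  have hint : Integrable (gaussianVectorPDF m v) :=
    Integrable.fintype_prod fun i => integrable_gaussianPDFReal _ _
  have hms : MeasurableSet (Set.univ.pi s) := MeasurableSet.univ_pi hs
  rw [withDensity_apply _ hms, ← ofReal_integral_eq_lintegral_ofReal hint.restrict
    (Eventually.of_forall fun x => gaussianVectorPDF_nonneg m x), ← integral_indicator hms]
  have h1 : (Set.univ.pi s).indicator (gaussianVectorPDF m v)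
      = fun x => ∏ i, (s i).indicator (gaussianPDFReal (m i) v) (x i) := by
    ext x
    by_cases hx : x ∈ Set.univ.pi s
    · rw [Set.indicator_of_mem hx, gaussianVectorPDF]
      exact Finset.prod_congr rfl fun i _ => (Set.indicator_of_mem (hx i trivial) _).symm
    · rw [Set.indicator_of_notMem hx]
      simp only [Set.mem_pi, Set.mem_univ, true_imp_iff, not_forall] at hx
      obtain ⟨i, hi⟩ := hx
      exact (Finset.prod_eq_zero (Finset.mem_univ i) (Set.indicator_of_notMem hi _)).symm
  rw [h1, integral_fintype_prod_volume_eq_prod, ENNReal.ofReal_prod_of_nonneg]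
  · refine Finset.prod_congr rfl fun i _ => ?_
    rw [gaussianReal_apply_eq_integral _ hv, integral_indicator (hs i)]
  · exact fun i _ => integral_nonneg fun x =>
      Set.indicator_nonneg (fun y _ => gaussianPDFReal_nonneg _ _ _) _

theorem gaussianVector_absolutelyContinuous (hv : v ≠ 0) :
    gaussianVector m v ≪ (volume : Measure (ι → ℝ)) := by
  rw [gaussianVector_eq_withDensity m hv]
  exact withDensity_absolutelyContinuous _ _

theorem integral_gaussianVector (hv : v ≠ 0) (h : (ι → ℝ) → ℝ) :
    ∫ x, h x ∂gaussianVector m v = ∫ x, h x * gaussianVectorPDF m v x := by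
  rw [gaussianVector_eq_withDensity m hv, integral_withDensity_eq_integral_toReal_smul
    ((contDiff_gaussianVectorPDF m (n := 0)).continuous.measurable.ennreal_ofReal)
    (Eventually.of_forall fun x => ENNReal.ofReal_lt_top)]
  refine integral_congr_ae (Eventually.of_forall fun x => ?_)
  simp only [ENNReal.toReal_ofReal (gaussianVectorPDF_nonneg m x), smul_eq_mul, mul_comm]

theorem memLp_eval_gaussianVector (i : ι) :
    MemLp (fun x : ι → ℝ => x i) 2 (gaussianVector m v) :=
  (memLp_id_gaussianReal 2).comp_measurePreserving (measurePreserving_eval _ i)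

theorem memLp_norm_gaussianVector :
    MemLp (fun x : ι → ℝ => ‖x‖) 2 (gaussianVector m v) := by
  have h : MemLp (fun x : ι → ℝ => ∑ i, ‖x i‖) 2 (gaussianVector m v) :=
    memLp_finsetSum _ fun i _ => (memLp_eval_gaussianVector m i).norm
  refine h.mono continuous_norm.aestronglyMeasurable (Eventually.of_forall fun x => ?_)
  rw [norm_norm, Real.norm_of_nonneg (Finset.sum_nonneg fun i _ => norm_nonneg _)]
  exact (pi_norm_le_iff_of_nonneg (Finset.sum_nonneg fun i _ => norm_nonneg _)).2 fun i =>
    Finset.single_le_sum (f := fun i => ‖x i‖) (fun i _ => norm_nonneg _) (Finset.mem_univ i)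

variable [DecidableEq ι]

theorem hasLineDerivAt_gaussianVectorPDF (hv : v ≠ 0) (x : ι → ℝ) (i : ι) :
    HasLineDerivAt ℝ (gaussianVectorPDF m v) (-((x i - m i) / v) * gaussianVectorPDF m v x) x
      (Pi.single i 1) := by
  have hv' : (v : ℝ) ≠ 0 := by exact_mod_cast hv
  have h1 : HasDerivAt (fun t : ℝ => gaussianPDFReal (m i) v (x i + t))
      (-((x i - m i) / v) * gaussianPDFReal (m i) v (x i)) 0 := by
    unfold gaussianPDFReal
    have h2 : HasDerivAt (fun t : ℝ => -(x i + t - m i) ^ 2 / (2 * v))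
        (-((x i - m i) / v)) 0 := by
      have := ((((hasDerivAt_id (0 : ℝ)).const_add (x i)).sub_const (m i)).pow 2).neg.div_const
        (2 * (v : ℝ))
      refine HasDerivAt.congr_deriv this ?_
      simp only [id, add_zero]
      field_simp
      norm_num
      ring
    refine HasDerivAt.congr_deriv (h2.exp.const_mul _) ?_
    simp only [add_zero]
    ring
  have h3 : (fun t : ℝ => gaussianVectorPDF m v (x + t • Pi.single i 1)) = fun t =>
      gaussianPDFReal (m i) v (x i + t) *
        ∏ j ∈ Finset.univ.erase i, gaussianPDFReal (m j) v (x j) := by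
    ext t
    rw [gaussianVectorPDF, ← Finset.mul_prod_erase _ _ (Finset.mem_univ i)]
    congr 1
    · simp
    · refine Finset.prod_congr rfl fun j hj => ?_
      simp [Finset.ne_of_mem_erase hj]
  unfold HasLineDerivAt
  rw [h3, gaussianVectorPDF, ← Finset.mul_prod_erase _ _ (Finset.mem_univ i), ← mul_assoc]
  exact h1.mul_const _

/-- Stein's identity for Lipschitz functions with compact support: integration by parts against
the Gaussian density. -/
theorem integral_lineDeriv_gaussianVector (hv : v ≠ 0) {G : (ι → ℝ) → ℝ} {C : ℝ≥0}
    (hG : LipschitzWith C G) (hsupp : HasCompactSupport G) (i : ι) :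
    ∫ x, lineDeriv ℝ G x (Pi.single i 1) ∂gaussianVector m v
      = (v : ℝ)⁻¹ * ∫ x, G x * (x i - m i) ∂gaussianVector m v := by
  obtain ⟨R, hR⟩ := hsupp.isCompact.isBounded.subset_closedBall (0 : ι → ℝ)
  -- a cutoff equal to one near the support turns the density into a Lipschitz function
  let b : ContDiffBump (0 : ι → ℝ) := ⟨|R| + 1, |R| + 2, by positivity, by linarith⟩
  have hb1 : ∀ x ∈ tsupport G, b =ᶠ[𝓝 x] fun _ => 1 := fun x hx => by
    refine b.eventuallyEq_one_of_mem_ball ?_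
    have := hR hx
    rw [mem_closedBall_zero_iff] at this
    rw [mem_ball_zero_iff]
    change ‖x‖ < |R| + 1
    linarith [le_abs_self R]
  have hgc : HasCompactSupport fun x => b x * gaussianVectorPDF m v x :=
    b.hasCompactSupport.mul_right
  obtain ⟨D, hgL⟩ := ContDiff.lipschitzWith_of_hasCompactSupport hgc
    ((b.contDiff (n := 1)).mul (contDiff_gaussianVectorPDF m (n := 1))) one_ne_zero
  have key := hG.integral_lineDeriv_mul_eq (μ := volume) hgL hgc (Pi.single i 1)
  have e1 : ∀ x, lineDeriv ℝ G x (Pi.single i 1) * (b x * gaussianVectorPDF m v x)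
      = lineDeriv ℝ G x (Pi.single i 1) * gaussianVectorPDF m v x := fun x => by
    by_cases hx : x ∈ tsupport G
    · rw [(hb1 x hx).eq_of_nhds, one_mul]
    · have : G =ᶠ[𝓝 x] fun _ => 0 := notMem_tsupport_iff_eventuallyEq.1 hx
      rw [this.lineDeriv_eq]
      simp [lineDeriv]
  have e2 : ∀ x, lineDeriv ℝ (fun x => b x * gaussianVectorPDF m v x) x (-Pi.single i 1) * G x
      = (v : ℝ)⁻¹ * (G x * (x i - m i) * gaussianVectorPDF m v x) := fun x => by
    by_cases hx : x ∈ tsupport G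
    · have : (fun x => b x * gaussianVectorPDF m v x) =ᶠ[𝓝 x] gaussianVectorPDF m v := by
        filter_upwards [hb1 x hx] with y hy
        rw [hy, one_mul]
      rw [this.lineDeriv_eq, lineDeriv_neg, (hasLineDerivAt_gaussianVectorPDF m hv x i).lineDeriv]
      field_simp
    · rw [image_eq_zero_of_notMem_tsupport hx]
      simp
  simp only [e1, e2] at key
  rw [integral_gaussianVector m hv, integral_gaussianVector m hv, key, integral_const_mul]

end Stein

/-! ### Stein's identity for fields with nonnegative divergence -/

section SteinNonneg

open Filter Topology Metric

/-- A radial cutoff supported in the ball of radius `N + 1`, tending to one as `N → ∞`. -/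
noncomputable def radialCutoff {E : Type*} [NormedAddCommGroup E] (N : ℕ) (x : E) : ℝ :=
  max 0 (1 - ‖x‖ / (N + 1))

section RadialCutoff

variable {E : Type*} [NormedAddCommGroup E] (N : ℕ)

theorem radialCutoff_nonneg (x : E) : 0 ≤ radialCutoff N x := le_max_left _ _

theorem radialCutoff_le_one (x : E) : radialCutoff N x ≤ 1 :=
  max_le zero_le_one (sub_le_self _ (by positivity))

theorem radialCutoff_eq_zero {x : E} (hx : (N : ℝ) + 1 ≤ ‖x‖) : radialCutoff N x = 0 := by
  refine max_eq_left (sub_nonpos.2 ?_)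
  rwa [le_div_iff₀ (by positivity), one_mul]

theorem lipschitzWith_radialCutoff :
    LipschitzWith (Real.toNNReal (1 / (N + 1))) (radialCutoff N : E → ℝ) := by
  refine LipschitzWith.of_dist_le_mul fun x y => ?_
  rw [Real.coe_toNNReal _ (by positivity), Real.dist_eq, dist_eq_norm]
  have h1 : |radialCutoff N x - radialCutoff N y|
      ≤ |(1 - ‖x‖ / ((N : ℝ) + 1)) - (1 - ‖y‖ / (N + 1))| :=
    (abs_max_sub_max_le_max _ _ _ _).trans_eq (by simp)
  refine h1.trans ?_
  have h2 : (1 - ‖x‖ / ((N : ℝ) + 1)) - (1 - ‖y‖ / (N + 1)) = 1 / ((N : ℝ) + 1) * (‖y‖ - ‖x‖) := by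
    ring
  rw [h2, abs_mul, abs_of_nonneg (by positivity : (0 : ℝ) ≤ 1 / ((N : ℝ) + 1))]
  refine mul_le_mul_of_nonneg_left ?_ (by positivity)
  rw [norm_sub_rev]
  exact abs_norm_sub_norm_le y x

theorem tendsto_radialCutoff (x : E) : Tendsto (fun N => radialCutoff N x) atTop (𝓝 1) := by
  have h1 : Tendsto (fun N : ℕ => ‖x‖ / ((N : ℝ) + 1)) atTop (𝓝 0) :=
    tendsto_const_nhds.div_atTop (tendsto_natCast_atTop_atTop.atTop_add tendsto_const_nhds)
  have h2 := (tendsto_const_nhds (x := (0 : ℝ))).max ((tendsto_const_nhds (x := (1 : ℝ))).sub h1)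
  simpa [radialCutoff] using h2

/-- Cutting off a function which is Lipschitz on balls makes it Lipschitz. -/
theorem exists_lipschitzWith_radialCutoff_mul {F : E → ℝ}
    (hF : ∀ R : ℝ, ∃ C : ℝ≥0, LipschitzOnWith C F (closedBall 0 R)) :
    ∃ C : ℝ≥0, LipschitzWith C fun x => radialCutoff N x * F x := by
  obtain ⟨C, hC⟩ := hF (N + 1)
  set M : ℝ := |F 0| + C * (N + 1) with hM
  have hM0 : 0 ≤ M := by positivity
  have hbound : ∀ x ∈ closedBall (0 : E) (N + 1), |F x| ≤ M := fun x hx => by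
    have h1 := hC.dist_le_mul x hx 0 (mem_closedBall_self (by positivity))
    rw [Real.dist_eq, dist_zero_right] at h1
    have h2 : |F x| ≤ |F 0| + |F x - F 0| := by
      calc |F x| = |F 0 + (F x - F 0)| := by ring_nf
        _ ≤ _ := abs_add_le _ _
    have h3 : (C : ℝ) * ‖x‖ ≤ C * (N + 1) :=
      mul_le_mul_of_nonneg_left (mem_closedBall_zero_iff.1 hx) C.2
    linarith
  have hcut : ∀ x y : E, |radialCutoff N x - radialCutoff N y| ≤ ‖x - y‖ := fun x y => by
    have h := (lipschitzWith_radialCutoff N).dist_le_mul x y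
    rw [Real.coe_toNNReal _ (by positivity), Real.dist_eq, dist_eq_norm] at h
    refine h.trans ?_
    have : 1 / ((N : ℝ) + 1) ≤ 1 := by rw [div_le_one (by positivity)]; simp
    nlinarith [norm_nonneg (x - y)]
  have hone : ∀ x y : E, x ∈ closedBall (0 : E) (N + 1) →
      |radialCutoff N x * F x - radialCutoff N y * F y| ≤ (C + M) * ‖x - y‖ := fun x y hx => by
    by_cases hy : y ∈ closedBall (0 : E) (N + 1)
    · have h1 := hC.dist_le_mul x hx y hy
      rw [Real.dist_eq, dist_eq_norm] at h1
      have e : radialCutoff N x * F x - radialCutoff N y * F y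
          = radialCutoff N y * (F x - F y) + (radialCutoff N x - radialCutoff N y) * F x := by ring
      rw [e]
      refine (abs_add_le _ _).trans ?_
      rw [abs_mul, abs_mul, abs_of_nonneg (radialCutoff_nonneg N y)]
      have h2 := mul_le_mul (radialCutoff_le_one N y) h1 (abs_nonneg _) zero_le_one
      have h3 := mul_le_mul (hcut x y) (hbound x hx) (abs_nonneg _) (norm_nonneg _)
      linarith
    · have h0 : radialCutoff N y = 0 := radialCutoff_eq_zero N
        (by rw [mem_closedBall_zero_iff, not_le] at hy; exact hy.le)
      have h2 := hcut x y
      rw [h0, sub_zero] at h2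
      rw [h0, zero_mul, sub_zero, abs_mul]
      have h3 := mul_le_mul h2 (hbound x hx) (abs_nonneg _) (norm_nonneg _)
      have h4 : 0 ≤ (C : ℝ) * ‖x - y‖ := by positivity
      linarith
  refine ⟨C + Real.toNNReal M, LipschitzWith.of_dist_le_mul fun x y => ?_⟩
  rw [NNReal.coe_add, Real.coe_toNNReal _ hM0, Real.dist_eq, dist_eq_norm]
  by_cases hx : x ∈ closedBall (0 : E) (N + 1)
  · exact hone x y hx
  · by_cases hy : y ∈ closedBall (0 : E) (N + 1)
    · rw [abs_sub_comm, norm_sub_rev]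
      exact hone y x hy
    · rw [mem_closedBall_zero_iff, not_le] at hx hy
      rw [radialCutoff_eq_zero N hx.le, radialCutoff_eq_zero N hy.le]
      simp only [zero_mul, sub_zero, abs_zero]
      positivity

theorem hasCompactSupport_radialCutoff_mul [ProperSpace E] (F : E → ℝ) :
    HasCompactSupport fun x => radialCutoff N x * F x := by
  refine HasCompactSupport.intro (isCompact_closedBall (0 : E) (N + 1)) fun x hx => ?_
  rw [mem_closedBall_zero_iff, not_le] at hx
  rw [radialCutoff_eq_zero N hx.le, zero_mul]

end RadialCutoff

theorem continuous_of_lipschitzOnWith_closedBall {E : Type*} [NormedAddCommGroup E] {F : E → ℝ}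
    (hF : ∀ R : ℝ, ∃ C : ℝ≥0, LipschitzOnWith C F (closedBall 0 R)) : Continuous F := by
  refine continuous_iff_continuousAt.2 fun x => ?_
  obtain ⟨C, hC⟩ := hF (‖x‖ + 1)
  refine hC.continuousOn.continuousAt (mem_of_superset (isOpen_ball.mem_nhds ?_) ball_subset_closedBall)
  rw [mem_ball_zero_iff]
  linarith

/-- Stein's identity for a vector field of linear growth which is Lipschitz on balls and whose
divergence is nonnegative almost everywhere. Nonnegativity gives integrability of the divergence
through Fatou's lemma, so no bound on the derivative at infinity is needed. -/
theorem integrable_and_integral_divergence_gaussianVector {ι : Type*} [Fintype ι] [DecidableEq ι]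
    (m : ι → ℝ) {v : ℝ≥0} (hv : v ≠ 0) {F : (ι → ℝ) → ι → ℝ} {K : ℝ} {D : (ι → ℝ) → ℝ}
    (hF : ∀ i, ∀ R : ℝ, ∃ C : ℝ≥0, LipschitzOnWith C (fun x => F x i) (closedBall 0 R))
    (hgrow : ∀ x i, |F x i| ≤ K * ‖x‖)
    (hdiff : ∀ᵐ x, ∀ i, DifferentiableAt ℝ (fun y => F y i) x)
    (hD : ∀ᵐ x, ∑ i, lineDeriv ℝ (fun y => F y i) x (Pi.single i 1) = D x)
    (hD0 : ∀ᵐ x, 0 ≤ D x) :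
    Integrable D (gaussianVector m v) ∧ ∫ x, D x ∂gaussianVector m v
      = (v : ℝ)⁻¹ * ∫ x, ∑ i, F x i * (x i - m i) ∂gaussianVector m v := by
  set μ := gaussianVector m v with hμ
  have hac : μ ≪ volume := gaussianVector_absolutelyContinuous m hv
  have hcont : ∀ i, Continuous fun x => F x i := fun i =>
    continuous_of_lipschitzOnWith_closedBall (hF i)
  have hK : ∀ x : ι → ℝ, ∀ _ : ι, 0 ≤ K * ‖x‖ := fun x i => (abs_nonneg _).trans (hgrow x i)
  have hW : ∀ i, Integrable (fun x => F x i * (x i - m i)) μ := fun i => by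
    have h1 : MemLp (fun x => F x i) 2 μ :=
      ((memLp_norm_gaussianVector m).const_mul K).mono (hcont i).aestronglyMeasurable
        (Eventually.of_forall fun x => by
          rw [Real.norm_eq_abs, Real.norm_of_nonneg (hK x i)]; exact hgrow x i)
    exact h1.integrable_mul ((memLp_eval_gaussianVector m i).sub (memLp_const (m i)))
  have hWs : Integrable (fun x => ∑ i, F x i * (x i - m i)) μ := integrable_finsetSum _ fun i _ => hW i
  -- the error made by cutting off
  set T : ℕ → (ι → ℝ) → ℝ := fun N x =>
    ∑ i, F x i * lineDeriv ℝ (radialCutoff N) x (Pi.single i 1) with hT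
  have hTbound : ∀ N x, ‖T N x‖ ≤ Fintype.card ι * (K * ‖x‖ * (1 / ((N : ℝ) + 1))) := fun N x => by
    refine (norm_sum_le _ _).trans ?_
    rw [← nsmul_eq_mul]
    refine Finset.sum_le_card_nsmul _ _ _ fun i _ => ?_
    rw [norm_mul, Real.norm_eq_abs]
    have h1 := norm_lineDeriv_le_of_lipschitz ℝ (lipschitzWith_radialCutoff (E := ι → ℝ) N)
      (x₀ := x) (v := Pi.single i 1)
    rw [Real.coe_toNNReal _ (by positivity), Pi.norm_single, norm_one, mul_one] at h1
    exact mul_le_mul (hgrow x i) h1 (norm_nonneg _) (hK x i)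
  have hTmeas : ∀ N, AEStronglyMeasurable (T N) μ := fun N =>
    Finset.aestronglyMeasurable_fun_sum _ fun i _ => ((hcont i).aestronglyMeasurable).mul
      (aestronglyMeasurable_lineDeriv (lipschitzWith_radialCutoff N).continuous μ)
  have hnorm : Integrable (fun x : ι → ℝ => ‖x‖) μ :=
    (memLp_norm_gaussianVector m).integrable one_le_two
  have hTint : ∀ N, Integrable (T N) μ := fun N =>
    (((hnorm.const_mul K).mul_const (1 / ((N : ℝ) + 1))).const_mul (Fintype.card ι : ℝ)).mono'
      (hTmeas N) (Eventually.of_forall (hTbound N))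
  have hTlim : Tendsto (fun N => ∫ x, T N x ∂μ) atTop (𝓝 0) := by
    have h1 : Tendsto (fun N : ℕ => 1 / ((N : ℝ) + 1)) atTop (𝓝 0) :=
      tendsto_one_div_add_atTop_nhds_zero_nat
    have h2 : ∀ N : ℕ, ‖∫ x, T N x ∂μ‖
        ≤ (∫ x, Fintype.card ι * (K * ‖x‖) ∂μ) * (1 / ((N : ℝ) + 1)) := fun N => by
      rw [← integral_mul_const]
      refine norm_integral_le_of_norm_le
        (((hnorm.const_mul K).const_mul _).mul_const _) (Eventually.of_forall fun x => ?_)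
      refine (hTbound N x).trans_eq ?_
      ring
    refine squeeze_zero_norm h2 ?_
    simpa using h1.const_mul (∫ x, Fintype.card ι * (K * ‖x‖) ∂μ)
  -- Stein's identity for the cut off field
  have hG : ∀ N i, ∃ C : ℝ≥0, LipschitzWith C fun x => radialCutoff N x * F x i := fun N i =>
    exists_lipschitzWith_radialCutoff_mul N (hF i)
  have hGint : ∀ N i, Integrable
      (fun x => lineDeriv ℝ (fun x => radialCutoff N x * F x i) x (Pi.single i 1)) μ := fun N i => by
    obtain ⟨C, hC⟩ := hG N i
    exact (hC.memLp_lineDeriv (μ := μ) (Pi.single i 1)).integrable le_top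
  have hsplit : ∀ N, ∀ᵐ x ∂μ,
      ∑ i, lineDeriv ℝ (fun x => radialCutoff N x * F x i) x (Pi.single i 1)
        = radialCutoff N x * D x + T N x := fun N => by
    have h1 : ∀ᵐ x ∂μ, DifferentiableAt ℝ (radialCutoff N) x :=
      hac.ae_le (lipschitzWith_radialCutoff (E := ι → ℝ) N).ae_differentiableAt
    filter_upwards [h1, hac.ae_le hdiff, hac.ae_le hD] with x hx1 hx2 hx3
    rw [← hx3, hT, Finset.mul_sum, ← Finset.sum_add_distrib]
    refine Finset.sum_congr rfl fun i _ => ?_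
    have h2 := (hx1.hasFDerivAt.mul (hx2 i).hasFDerivAt).hasLineDerivAt (Pi.single i 1)
    have h3 : HasLineDerivAt ℝ (fun x => radialCutoff N x * F x i) _ x (Pi.single i 1) := h2
    rw [h3.lineDeriv, (hx2 i).lineDeriv_eq_fderiv, hx1.lineDeriv_eq_fderiv]
    simp
  have hcutD : ∀ N, Integrable (fun x => radialCutoff N x * D x) μ := fun N => by
    refine ((integrable_finsetSum Finset.univ fun i _ => hGint N i).sub (hTint N)).congr ?_
    filter_upwards [hsplit N] with x hx
    simp only [Pi.sub_apply]
    rw [hx, add_sub_cancel_right]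
  have hident : ∀ N, ∫ x, radialCutoff N x * D x ∂μ
      = (v : ℝ)⁻¹ * ∫ x, radialCutoff N x * ∑ i, F x i * (x i - m i) ∂μ - ∫ x, T N x ∂μ := fun N => by
    have h1 : ∫ x, radialCutoff N x * D x ∂μ + ∫ x, T N x ∂μ
        = ∑ i, ∫ x, lineDeriv ℝ (fun x => radialCutoff N x * F x i) x (Pi.single i 1) ∂μ := by
      rw [← integral_add (hcutD N) (hTint N), ← integral_finsetSum _ fun i _ => hGint N i]
      exact integral_congr_ae ((hsplit N).mono fun x hx => hx.symm)
    have h2 : ∀ i, ∫ x, lineDeriv ℝ (fun x => radialCutoff N x * F x i) x (Pi.single i 1) ∂μ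
        = (v : ℝ)⁻¹ * ∫ x, radialCutoff N x * F x i * (x i - m i) ∂μ := fun i => by
      obtain ⟨C, hC⟩ := hG N i
      exact integral_lineDeriv_gaussianVector m hv hC (hasCompactSupport_radialCutoff_mul N _) i
    have h3 : ∀ i, Integrable (fun x => radialCutoff N x * F x i * (x i - m i)) μ := fun i => by
      refine (hW i).mono ((((lipschitzWith_radialCutoff N).continuous.mul (hcont i)).mul
        ((continuous_apply i).sub continuous_const)).aestronglyMeasurable)
        (Eventually.of_forall fun x => ?_)
      rw [mul_assoc, norm_mul, Real.norm_of_nonneg (radialCutoff_nonneg N x)]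
      exact mul_le_of_le_one_left (norm_nonneg _) (radialCutoff_le_one N x)
    rw [eq_sub_iff_add_eq, h1]
    simp only [h2]
    rw [← Finset.mul_sum, ← integral_finsetSum _ fun i _ => h3 i]
    simp only [Finset.mul_sum, mul_assoc]
  have hlimW : Tendsto (fun N => ∫ x, radialCutoff N x * ∑ i, F x i * (x i - m i) ∂μ) atTop
      (𝓝 (∫ x, ∑ i, F x i * (x i - m i) ∂μ)) := by
    refine tendsto_integral_of_dominated_convergence (fun x => ‖∑ i, F x i * (x i - m i)‖)
      (fun N => (lipschitzWith_radialCutoff N).continuous.aestronglyMeasurable.mul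
        hWs.aestronglyMeasurable) hWs.norm (fun N => Eventually.of_forall fun x => ?_)
      (Eventually.of_forall fun x => ?_)
    · rw [norm_mul, Real.norm_of_nonneg (radialCutoff_nonneg N x)]
      exact mul_le_of_le_one_left (norm_nonneg _) (radialCutoff_le_one N x)
    · simpa using (tendsto_radialCutoff x).mul_const (∑ i, F x i * (x i - m i))
  have hlim : Tendsto (fun N => ∫ x, radialCutoff N x * D x ∂μ) atTop
      (𝓝 ((v : ℝ)⁻¹ * ∫ x, ∑ i, F x i * (x i - m i) ∂μ)) := by
    simp only [hident]
    simpa using (hlimW.const_mul (v : ℝ)⁻¹).sub hTlim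
  have hptw : ∀ x, Tendsto (fun N => radialCutoff N x * D x) atTop (𝓝 (D x)) := fun x => by
    simpa using (tendsto_radialCutoff x).mul_const (D x)
  have hD0' : ∀ᵐ x ∂μ, 0 ≤ D x := hac.ae_le hD0
  have hDint : Integrable D μ := integrable_of_tendsto_of_tendsto_integral hcutD
    (fun N => hD0'.mono fun x hx => mul_nonneg (radialCutoff_nonneg N x) hx)
    (Eventually.of_forall hptw) hlim
  refine ⟨hDint, tendsto_nhds_unique ?_ hlim⟩
  refine tendsto_integral_of_dominated_convergence (fun x => ‖D x‖)
    (fun N => (hcutD N).aestronglyMeasurable) hDint.norm (fun N => Eventually.of_forall fun x => ?_)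
    (Eventually.of_forall hptw)
  rw [norm_mul, Real.norm_of_nonneg (radialCutoff_nonneg N x)]
  exact mul_le_of_le_one_left (norm_nonneg _) (radialCutoff_le_one N x)

end SteinNonneg

/-! ### Distinct positive singular values almost everywhere -/

/-- The Hankel determinant `det (tr A^(i+j+1))`, `i, j < k`, of power sums of the eigenvalues of
`A = Bᵀ B`. It is a polynomial in the entries of `B`; the coefficients are in a commutative ring so
that it can be evaluated at matrices of polynomials. -/
noncomputable def gramHankelDet {R : Type*} [CommRing R] {n q : ℕ} (k : ℕ)
    (B : Matrix (Fin n) (Fin q) R) : R :=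
  det (of fun i j : Fin k => trace ((Bᵀ * B) ^ (i.val + j.val + 1)))

theorem IsEigenDecomp.trace_pow {q : ℕ} {A U : Matrix (Fin q) (Fin q) ℝ} {μ : Fin q → ℝ}
    (h : IsEigenDecomp A U μ) (m : ℕ) : trace (A ^ m) = ∑ k, μ k ^ m := by
  have hU' : U * Uᵀ = 1 := mul_eq_one_comm.mp h.orth
  have : ∀ m : ℕ, A ^ m = U * diagonal (fun k => μ k ^ m) * Uᵀ := by
    intro m
    induction m with
    | zero => simp [hU']
    | succ m ih =>
      rw [pow_succ, ih, h.eq_mul, conj_diagonal_mul_conj_diagonal h.orth]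
      simp only [pow_succ]
  rw [this, trace_conj_diagonal h.orth]

/-- The Hankel determinant is the product of the eigenvalues times a squared Vandermonde
determinant. -/
theorem ThinSVD.gramHankelDet_ne_zero_iff {n q k : ℕ} {B : Matrix (Fin n) (Fin q) ℝ}
    (T : ThinSVD B k) (hk : k ≤ q) :
    gramHankelDet k B ≠ 0 ↔ StrictAnti T.d ∧ ∀ i, 0 < T.d i := by
  have h := T.isFullDecomp hk
  set V := vandermonde fun i => T.d i ^ 2 with hV
  have hH : (of fun i j : Fin k => trace ((Bᵀ * B) ^ (i.val + j.val + 1)))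
      = Vᵀ * diagonal (fun i => T.d i ^ 2) * V := by
    ext i j
    rw [of_apply, h.eigen.trace_pow, Fin.sum_univ_eq_sum_castLE_add hk _ 0 fun l hl => by
      simp [h.tail l hl], Matrix.mul_apply]
    simp only [h.head, mul_zero, add_zero, mul_diagonal, transpose_apply, hV, vandermonde_apply]
    exact Finset.sum_congr rfl fun l _ => by ring
  rw [gramHankelDet, hH, det_mul, det_mul, det_transpose, det_diagonal]
  have hinj : V.det ≠ 0 ↔ Function.Injective fun i => T.d i ^ 2 := det_vandermonde_ne_zero_iff
  rw [mul_ne_zero_iff, mul_ne_zero_iff, hinj, Finset.prod_ne_zero_iff]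
  constructor
  · rintro ⟨⟨hi, h0⟩, -⟩
    have hpos : ∀ i, 0 < T.d i := fun i => lt_of_le_of_ne (T.nonneg_d i) fun h' => by
      have := h0 i (Finset.mem_univ i)
      rw [← h'] at this
      simp at this
    refine ⟨T.antitone_d.strictAnti_of_injective fun i j hij => hi ?_, hpos⟩
    simp only [hij]
  · rintro ⟨hd, hpos⟩
    have : Function.Injective fun i => T.d i ^ 2 := fun i j hij =>
      hd.injective ((pow_left_inj₀ (hpos i).le (hpos j).le two_ne_zero).1 hij)
    exact ⟨⟨this, fun i _ => (pow_pos (hpos i) 2).ne'⟩, this⟩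

theorem gramHankelDet_smul {n q k : ℕ} (c : ℝ) (B : Matrix (Fin n) (Fin q) ℝ) :
    gramHankelDet k (c • B)
      = (∏ i : Fin k, c ^ (2 * i.val + 2)) * ((∏ j : Fin k, c ^ (2 * j.val)) * gramHankelDet k B) := by
  rw [gramHankelDet, gramHankelDet, ← det_mul_row, ← det_mul_column]
  congr 1
  ext i j
  simp only [of_apply, transpose_smul, Matrix.smul_mul, Matrix.mul_smul, smul_smul, smul_pow,
    trace_smul, smul_eq_mul]
  ring

theorem continuous_gramHankelDet {n q k : ℕ} :
    Continuous (gramHankelDet k : Matrix (Fin n) (Fin q) ℝ → ℝ) := by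
  unfold gramHankelDet
  refine Continuous.matrix_det (continuous_matrix fun i j => ?_)
  simp only [of_apply]
  exact ((continuous_id.matrix_transpose.matrix_mul continuous_id).pow _).matrix_trace

/-- Along a line the Hankel determinant is a polynomial. -/
theorem exists_polynomial_eval_eq_gramHankelDet {n q k : ℕ} (A B : Matrix (Fin n) (Fin q) ℝ) :
    ∃ P : Polynomial ℝ, ∀ s, P.eval s = gramHankelDet k (s • A + B) := by
  let N : Matrix (Fin n) (Fin q) (Polynomial ℝ) :=
    of fun i j => Polynomial.X * Polynomial.C (A i j) + Polynomial.C (B i j)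
  refine ⟨gramHankelDet k N, fun s => ?_⟩
  have hN : N.map (Polynomial.evalRingHom s) = s • A + B := by
    ext i j
    change Polynomial.eval s (Polynomial.X * Polynomial.C (A i j) + Polynomial.C (B i j))
      = s * A i j + B i j
    rw [Polynomial.eval_add, Polynomial.eval_mul, Polynomial.eval_X, Polynomial.eval_C,
      Polynomial.eval_C]
  rw [← Polynomial.coe_evalRingHom, gramHankelDet, RingHom.map_det, gramHankelDet]
  congr 1
  ext i j
  rw [RingHom.mapMatrix_apply, map_apply, of_apply, of_apply, AddMonoidHom.map_trace]
  congr 1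
  have : (Nᵀ * N).map (Polynomial.evalRingHom s) = (s • A + B)ᵀ * (s • A + B) := by
    rw [Matrix.map_mul, ← hN, transpose_map]
  rw [← this]
  exact map_pow (Polynomial.evalRingHom s).mapMatrix _ _

/-- Some response has a fit with distinct positive singular values. -/
theorem exists_gramHankelDet_lsFit_ne_zero {n p : ℕ} (q : ℕ) (X : Matrix (Fin n) (Fin p) ℝ) :
    ∃ Y : Matrix (Fin n) (Fin q) ℝ, gramHankelDet (min X.rank q) (lsFit X Y) ≠ 0 := by
  obtain ⟨W, hW, hhat⟩ := exists_hat_eq_mul_transpose X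
  set k := min X.rank q with hk
  have hkr : k ≤ X.rank := min_le_left _ _
  have hkq : k ≤ q := min_le_right _ _
  -- any distinct positive values serve as singular values
  set d : Fin k → ℝ := fun i => (k : ℝ) - i.val with hd
  set W₁ : Matrix (Fin n) (Fin k) ℝ := W.submatrix id (Fin.castLE hkr) with hW₁
  set V : Matrix (Fin q) (Fin k) ℝ :=
    (1 : Matrix (Fin q) (Fin q) ℝ).submatrix id (Fin.castLE hkq) with hV
  have hdpos : ∀ i, 0 < d i := fun i => sub_pos.2 (by exact_mod_cast i.2)
  have hdanti : StrictAnti d := fun i j hij =>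
    sub_lt_sub_left (by exact_mod_cast (Fin.lt_def.1 hij)) _
  have hfit : lsFit X (W₁ * diagonal d * Vᵀ) = W₁ * diagonal d * Vᵀ := by
    have : W * Wᵀ * W₁ = W₁ := by
      have h1 : W₁ = W * (1 : Matrix (Fin X.rank) (Fin X.rank) ℝ).submatrix id (Fin.castLE hkr) := by
        ext a i
        simp [hW₁, Matrix.mul_apply, one_apply]
      rw [h1]
      calc _ = W * (Wᵀ * W) * (1 : Matrix (Fin X.rank) (Fin X.rank) ℝ).submatrix id
              (Fin.castLE hkr) := by simp only [Matrix.mul_assoc]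
        _ = _ := by rw [hW, Matrix.mul_one]
    rw [lsFit, hhat, ← Matrix.mul_assoc, ← Matrix.mul_assoc, this]
  have hWW : W₁ᵀ * W₁ = 1 := by
    ext i j
    have := congrFun (congrFun hW (Fin.castLE hkr i)) (Fin.castLE hkr j)
    simpa [hW₁, Matrix.mul_apply, one_apply] using this
  have hVV : Vᵀ * V = 1 := by
    ext i j
    simp [hV, Matrix.mul_apply, one_apply]
  refine ⟨W₁ * diagonal d * Vᵀ, ?_⟩
  rw [hfit]
  let T : ThinSVD (W₁ * diagonal d * Vᵀ) k :=
    ⟨W₁, d, V, hWW, hVV, hdanti.antitone, fun i => (hdpos i).le, rfl⟩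
  exact (T.gramHankelDet_ne_zero_iff hkq).2 ⟨hdanti, hdpos⟩

/-- The matrix with the given entries. Functions on pairs of indices carry the norm and the product
measure that matrices lack. -/
def vecToMatrix {n q : ℕ} (x : Fin n × Fin q → ℝ) : Matrix (Fin n) (Fin q) ℝ :=
  of fun i j => x (i, j)

/-- Almost every response has a fit with distinct positive singular values: on each line in the
direction of one such response, only finitely many points fail. -/
theorem ae_strictAnti_and_pos {n p q : ℕ} (X : Matrix (Fin n) (Fin p) ℝ)
    (S : ∀ Y : Matrix (Fin n) (Fin q) ℝ, ThinSVD (lsFit X Y) (min X.rank q)) :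
    ∀ᵐ x : Fin n × Fin q → ℝ, StrictAnti (S (vecToMatrix x)).d ∧
      ∀ k, 0 < (S (vecToMatrix x)).d k := by
  obtain ⟨Y₀, hY₀⟩ := exists_gramHankelDet_lsFit_ne_zero q X
  set g : (Fin n × Fin q → ℝ) → ℝ := fun x =>
    gramHankelDet (min X.rank q) (lsFit X (vecToMatrix x)) with hg
  have hcont : Continuous g := by
    refine continuous_gramHankelDet.comp (continuous_const.matrix_mul ?_)
    exact continuous_matrix fun i j => continuous_apply (i, j)
  have hmeas : MeasurableSet {x | g x ≠ 0} := hcont.measurable (measurableSet_singleton 0).compl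
  set x₀ : Fin n × Fin q → ℝ := fun ij => Y₀ ij.1 ij.2 with hx₀
  let L : ℝ →ₗ[ℝ] (Fin n × Fin q → ℝ) := LinearMap.toSpanSingleton ℝ _ x₀
  have hline : ∀ y, ∀ᵐ t : ℝ, y + L t ∈ {x | g x ≠ 0} := by
    intro y
    obtain ⟨P, hP⟩ := exists_polynomial_eval_eq_gramHankelDet (k := min X.rank q)
      (lsFit X (vecToMatrix y)) (lsFit X Y₀)
    have hP0 : P ≠ 0 := by
      rintro rfl
      have := hP 0
      rw [zero_smul, zero_add] at this
      exact hY₀ (by rw [← this]; simp)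
    have hfin : ({0} ∪ {t : ℝ | P.eval t⁻¹ = 0}).Finite := by
      refine (Set.finite_singleton 0).union ?_
      have h1 : {s : ℝ | P.IsRoot s}.Finite := Polynomial.finite_setOfPred_isRoot hP0
      exact h1.preimage (inv_injective.injOn)
    filter_upwards [hfin.countable.ae_notMem volume] with t ht
    simp only [Set.mem_union, Set.mem_singleton_iff, Set.mem_ofPred_eq, not_or] at ht
    obtain ⟨ht0, htP⟩ := ht
    have e : lsFit X (vecToMatrix (y + L t))
        = t • (t⁻¹ • lsFit X (vecToMatrix y) + lsFit X Y₀) := by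
      have h1 : vecToMatrix (y + L t) = vecToMatrix y + t • Y₀ := by
        ext i j
        simp [vecToMatrix, L, hx₀]
      rw [h1, smul_add, smul_smul, mul_inv_cancel₀ ht0, one_smul]
      simp [lsFit, Matrix.mul_add]
    change g (y + L t) ≠ 0
    rw [hg]
    simp only
    rw [e, gramHankelDet_smul, ← hP]
    exact mul_ne_zero (Finset.prod_ne_zero_iff.2 fun i _ => pow_ne_zero _ ht0)
      (mul_ne_zero (Finset.prod_ne_zero_iff.2 fun i _ => pow_ne_zero _ ht0) htP)
  filter_upwards [ae_mem_of_ae_add_linearMap_mem L volume volume hmeas hline] with x hx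
  exact ((S (vecToMatrix x)).gramHankelDet_ne_zero_iff (min_le_right _ _)).1 hx

/-! ### The spectral gap and the regularised fit -/

theorem headSum_succ {q j : ℕ} (μ : Fin q → ℝ) (hj : j < q) :
    headSum μ (j + 1) = headSum μ j + μ ⟨j, hj⟩ := by
  have : ∀ k : Fin q, headInd (j + 1) k * μ k
      = headInd j k * μ k + if k = ⟨j, hj⟩ then μ k else 0 := by
    intro k
    unfold headInd
    by_cases h1 : k = ⟨j, hj⟩
    · subst h1; simp
    · have h2 : k.val ≠ j := fun h => h1 (Fin.ext h)
      have h3 : k.val < j + 1 ↔ k.val < j := by omega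
      simp [h1, h3]
  simp only [headSum, this, Finset.sum_add_distrib]
  simp

theorem headInd_mul_headInd {q r j : ℕ} (k : Fin q) :
    headInd r k * headInd j k = headInd (min r j) k := by
  unfold headInd
  by_cases h1 : k.val < r <;> by_cases h2 : k.val < j <;> simp [h1, h2]

/-- For `A = Bᵀ B`, moving `B` in the direction of its leading part `B Q` changes `A` by `Q A + A Q`,
which scales the leading `r` eigenvalues only. -/
theorem IsEigenDecomp.trace_headProj_anticomm {q r j : ℕ} {A U : Matrix (Fin q) (Fin q) ℝ}
    {μ : Fin q → ℝ} (h : IsEigenDecomp A U μ) :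
    trace ((headProj U r * A + A * headProj U r) * headProj U j) = 2 * headSum μ (min r j) := by
  rw [h.eq_mul, headProj, headProj, conj_diagonal_mul_conj_diagonal h.orth,
    conj_diagonal_mul_conj_diagonal h.orth, Matrix.add_mul, conj_diagonal_mul_conj_diagonal h.orth,
    conj_diagonal_mul_conj_diagonal h.orth, trace_add, trace_conj_diagonal h.orth,
    trace_conj_diagonal h.orth, headSum, ← Finset.sum_add_distrib, Finset.mul_sum]
  refine Finset.sum_congr rfl fun k _ => ?_
  rw [← headInd_mul_headInd]
  ring

/-- The difference of the `r`-th and the `(r+1)`-st entry of `μ`, counted from one. It is written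
through partial sums, which are Lipschitz in the matrix and differentiable wherever there is a gap. -/
def specGap {q : ℕ} (μ : Fin q → ℝ) (r : ℕ) : ℝ :=
  2 * headSum μ r - headSum μ (r - 1) - headSum μ (r + 1)

theorem specGap_eq {q r : ℕ} (μ : Fin q → ℝ) (hr0 : 1 ≤ r) (hr : r < q) :
    specGap μ r = μ ⟨r - 1, by omega⟩ - μ ⟨r, hr⟩ := by
  obtain ⟨s, rfl⟩ := Nat.exists_eq_add_of_le' hr0
  unfold specGap
  rw [headSum_succ μ hr, headSum_succ μ (show s < q by omega)]
  simp only [Nat.add_sub_cancel]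
  ring

theorem specGap_nonneg {q r : ℕ} {μ : Fin q → ℝ} (hμ : Antitone μ) (hr0 : 1 ≤ r) (hr : r < q) :
    0 ≤ specGap μ r := by
  rw [specGap_eq μ hr0 hr, sub_nonneg]
  exact hμ (Fin.le_def.2 (by simp))

section Bounds

attribute [local instance] Matrix.frobeniusNormedAddCommGroup Matrix.frobeniusNormedSpace

theorem IsEigenDecomp.norm_headProj_sub_le_specGap {q r : ℕ} (hr0 : 1 ≤ r) (hr : r < q)
    {A U A' U' : Matrix (Fin q) (Fin q) ℝ} {μ μ' : Fin q → ℝ} (h : IsEigenDecomp A U μ)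
    (h' : IsEigenDecomp A' U' μ') (hγ : 0 < specGap μ r) :
    ‖headProj U r - headProj U' r‖ ≤ 2 / specGap μ r * ‖A - A'‖ := by
  refine h.norm_headProj_sub_le (c := μ ⟨r, hr⟩) hr.le h' hγ (fun k hk => ?_) fun l hl => ?_
  · rw [specGap_eq μ hr0 hr, add_sub_cancel]
    exact h.anti (Fin.le_def.2 (by simp; omega))
  · exact h.anti (Fin.mk_le_of_le_val hl)

theorem IsEigenDecomp.abs_specGap_sub_le {q r : ℕ} (hr : r < q)
    {A U A' U' : Matrix (Fin q) (Fin q) ℝ} {μ μ' : Fin q → ℝ} (h : IsEigenDecomp A U μ)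
    (h' : IsEigenDecomp A' U' μ') : |specGap μ r - specGap μ' r| ≤ 4 * √q * ‖A - A'‖ := by
  have hle : ∀ j ≤ q, |headSum μ j - headSum μ' j| ≤ √q * ‖A - A'‖ := fun j hj =>
    (h.abs_headSum_sub_le hj h').trans (mul_le_mul_of_nonneg_right
      (Real.sqrt_le_sqrt (by exact_mod_cast hj)) (norm_nonneg _))
  have h1 := abs_le.1 (hle r hr.le)
  have h2 := abs_le.1 (hle (r - 1) (by omega))
  have h3 := abs_le.1 (hle (r + 1) hr)
  unfold specGap
  rw [abs_le]
  constructor <;> linarith [h1.1, h1.2, h2.1, h2.2, h3.1, h3.2]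

theorem norm_vecToMatrix_le {n q : ℕ} (x : Fin n × Fin q → ℝ) :
    ‖vecToMatrix x‖ ≤ √(n * q) * ‖x‖ := by
  refine abs_le_of_sq_le_sq' ?_ (by positivity) |>.2
  rw [frobenius_norm_sq_eq, mul_pow, Real.sq_sqrt (by positivity)]
  calc ∑ i, ∑ j, vecToMatrix x i j ^ 2 ≤ ∑ _i : Fin n, ∑ _j : Fin q, ‖x‖ ^ 2 :=
        Finset.sum_le_sum fun i _ => Finset.sum_le_sum fun j _ => by
          rw [← sq_abs]
          exact pow_le_pow_left₀ (abs_nonneg _) (norm_le_pi_norm x (i, j)) 2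
    _ = n * q * ‖x‖ ^ 2 := by simp [mul_assoc]

theorem vecToMatrix_sub {n q : ℕ} (x y : Fin n × Fin q → ℝ) :
    vecToMatrix (x - y) = vecToMatrix x - vecToMatrix y := by
  ext i j; simp [vecToMatrix]

/-- The least squares fit is a bounded linear map. -/
theorem exists_norm_lsFit_vecToMatrix_le {n p q : ℕ} (X : Matrix (Fin n) (Fin p) ℝ) :
    ∃ a : ℝ, 0 ≤ a ∧ (∀ x : Fin n × Fin q → ℝ, ‖lsFit X (vecToMatrix x)‖ ≤ a * ‖x‖) ∧
      ∀ x y : Fin n × Fin q → ℝ,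
        ‖lsFit X (vecToMatrix x) - lsFit X (vecToMatrix y)‖ ≤ a * ‖x - y‖ := by
  have h1 : ∀ x : Fin n × Fin q → ℝ, ‖lsFit X (vecToMatrix x)‖
      ≤ ‖X * gramPinv X * Xᵀ‖ * √(n * q) * ‖x‖ := fun x => by
    rw [mul_assoc]
    exact (frobenius_norm_mul _ _).trans
      (mul_le_mul_of_nonneg_left (norm_vecToMatrix_le x) (norm_nonneg _))
  refine ⟨_, by positivity, h1, fun x y => ?_⟩
  have : lsFit X (vecToMatrix x) - lsFit X (vecToMatrix y) = lsFit X (vecToMatrix (x - y)) := by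
    rw [vecToMatrix_sub, lsFit, lsFit, lsFit, Matrix.mul_sub]
  rw [this]
  exact h1 _

/-- The regularised reduced rank fit: the factor `γ / (γ + ε)`, where `γ` is the spectral gap after
the `r`-th eigenvalue, compensates the blow-up of the derivative as the gap closes. -/
noncomputable def regFit {n p q k : ℕ} (X : Matrix (Fin n) (Fin p) ℝ)
    (S : ∀ Y : Matrix (Fin n) (Fin q) ℝ, ThinSVD (lsFit X Y) k) (hk : k ≤ q) (r : ℕ) (ε : ℝ)
    (x : Fin n × Fin q → ℝ) (ij : Fin n × Fin q) : ℝ :=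
  specGap ((S (vecToMatrix x)).eig hk) r / (specGap ((S (vecToMatrix x)).eig hk) r + ε) *
    rrFit X S r (vecToMatrix x) ij.1 ij.2

variable {n p q k r : ℕ} {X : Matrix (Fin n) (Fin p) ℝ}
  {S : ∀ Y : Matrix (Fin n) (Fin q) ℝ, ThinSVD (lsFit X Y) k}

theorem exists_abs_rrFit_vecToMatrix_le (hk : k ≤ q) (hr : r ≤ k) :
    ∃ K : ℝ, ∀ (x : Fin n × Fin q → ℝ) (ij : Fin n × Fin q),
      |rrFit X S r (vecToMatrix x) ij.1 ij.2| ≤ K * ‖x‖ := by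
  obtain ⟨a, ha, h1, -⟩ := exists_norm_lsFit_vecToMatrix_le (q := q) X
  refine ⟨a * √r, fun x ij => (abs_apply_le_frobenius _ _ _).trans ?_⟩
  rw [rrFit_eq hk hr]
  have h2 := norm_headProj_le (hr.trans hk) ((S (vecToMatrix x)).isFullDecomp hk).eigen.orth
  calc _ ≤ ‖lsFit X (vecToMatrix x)‖ * ‖headProj ((S (vecToMatrix x)).basis hk) r‖ :=
        frobenius_norm_mul _ _
    _ ≤ (a * ‖x‖) * √r := mul_le_mul (h1 x) h2 (norm_nonneg _) (by positivity)
    _ = _ := by ring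

/-- The regularised fit is Lipschitz on balls, although the fit itself is discontinuous where the
gap vanishes. -/
theorem exists_lipschitzOnWith_regFit (hk : k ≤ q) (hr0 : 1 ≤ r) (hr : r < k) {ε : ℝ} (hε : 0 < ε)
    (ij : Fin n × Fin q) (R : ℝ) :
    ∃ C : ℝ≥0, LipschitzOnWith C (fun x => regFit X S hk r ε x ij) (Metric.closedBall 0 R) := by
  obtain ⟨a, ha, hfit, hfit'⟩ := exists_norm_lsFit_vecToMatrix_le (q := q) X
  set B : (Fin n × Fin q → ℝ) → Matrix (Fin n) (Fin q) ℝ := fun x => lsFit X (vecToMatrix x)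
  set U : (Fin n × Fin q → ℝ) → Matrix (Fin q) (Fin q) ℝ :=
    fun x => (S (vecToMatrix x)).basis hk with hU
  set μ : (Fin n × Fin q → ℝ) → Fin q → ℝ := fun x => (S (vecToMatrix x)).eig hk with hμ
  set g : (Fin n × Fin q → ℝ) → ℝ := fun x => specGap (μ x) r with hg
  have hE : ∀ x, IsEigenDecomp ((B x)ᵀ * B x) (U x) (μ x) := fun x =>
    ((S (vecToMatrix x)).isFullDecomp hk).eigen
  have hrq : r < q := hr.trans_le hk
  have hg0 : ∀ x, 0 ≤ g x := fun x => specGap_nonneg (hE x).anti hr0 hrq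
  have hproj : ∀ x, ‖headProj (U x) r‖ ≤ √r := fun x => norm_headProj_le hrq.le (hE x).orth
  set R' : ℝ := |R| with hR'
  have hball : ∀ x ∈ Metric.closedBall (0 : Fin n × Fin q → ℝ) R, ‖B x‖ ≤ a * R' := fun x hx =>
    (hfit x).trans (mul_le_mul_of_nonneg_left
      ((mem_closedBall_zero_iff.1 hx).trans (le_abs_self R)) ha)
  have hgram : ∀ x ∈ Metric.closedBall (0 : Fin n × Fin q → ℝ) R,
      ∀ y ∈ Metric.closedBall (0 : Fin n × Fin q → ℝ) R,
      ‖(B x)ᵀ * B x - (B y)ᵀ * B y‖ ≤ 2 * a * R' * a * ‖x - y‖ := fun x hx y hy => by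
    have e : (B x)ᵀ * B x - (B y)ᵀ * B y = (B x)ᵀ * (B x - B y) + (B x - B y)ᵀ * B y := by
      rw [transpose_sub, Matrix.mul_sub, Matrix.sub_mul]; abel
    rw [e]
    have h1 : ‖(B x)ᵀ * (B x - B y)‖ ≤ (a * R') * (a * ‖x - y‖) := by
      refine (frobenius_norm_mul _ _).trans ?_
      rw [frobenius_norm_transpose]
      exact mul_le_mul (hball x hx) (hfit' x y) (norm_nonneg _) (by positivity)
    have h2 : ‖(B x - B y)ᵀ * B y‖ ≤ (a * ‖x - y‖) * (a * R') := by
      refine (frobenius_norm_mul _ _).trans ?_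
      rw [frobenius_norm_transpose]
      exact mul_le_mul (hfit' x y) (hball y hy) (norm_nonneg _) (by positivity)
    refine (norm_add_le _ _).trans ((add_le_add h1 h2).trans_eq ?_)
    ring
  -- the weight absorbs the factor `1 / γ` in the modulus of continuity of the projection
  have hweight : ∀ x y, g x / (g x + ε) * ‖headProj (U x) r - headProj (U y) r‖
      ≤ 2 / ε * ‖(B x)ᵀ * B x - (B y)ᵀ * B y‖ := fun x y => by
    rcases (hg0 x).eq_or_lt with h0 | h0
    · rw [← h0]; simp only [zero_div, zero_mul]; positivity
    · have h1 := (hE x).norm_headProj_sub_le_specGap hr0 hrq (hE y) h0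
      calc _ ≤ g x / (g x + ε) * (2 / g x * ‖(B x)ᵀ * B x - (B y)ᵀ * B y‖) :=
            mul_le_mul_of_nonneg_left h1 (by positivity)
        _ = 2 / (g x + ε) * ‖(B x)ᵀ * B x - (B y)ᵀ * B y‖ := by field_simp
        _ ≤ _ := by
            refine mul_le_mul_of_nonneg_right ?_ (norm_nonneg _)
            exact div_le_div_of_nonneg_left two_pos.le hε (by linarith)
  have hweight' : ∀ x y, |g x / (g x + ε) - g y / (g y + ε)|
      ≤ 4 * √q / ε * ‖(B x)ᵀ * B x - (B y)ᵀ * B y‖ := fun x y => by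
    have h1 : |g x - g y| ≤ 4 * √q * ‖(B x)ᵀ * B x - (B y)ᵀ * B y‖ :=
      (hE x).abs_specGap_sub_le hrq (hE y)
    have hx := hg0 x
    have hy := hg0 y
    have e : g x / (g x + ε) - g y / (g y + ε) = ε / ((g x + ε) * (g y + ε)) * (g x - g y) := by
      field_simp; ring
    rw [e, abs_mul, abs_of_nonneg (by positivity : 0 ≤ ε / ((g x + ε) * (g y + ε)))]
    have h2 : ε / ((g x + ε) * (g y + ε)) ≤ 1 / ε := by
      rw [div_le_div_iff₀ (by positivity) hε]
      nlinarith [mul_nonneg hx hy]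
    calc _ ≤ 1 / ε * (4 * √q * ‖(B x)ᵀ * B x - (B y)ᵀ * B y‖) :=
          mul_le_mul h2 h1 (abs_nonneg _) (by positivity)
      _ = _ := by ring
  set C : ℝ := a * √r + a * R' * (2 / ε * (2 * a * R' * a))
    + 4 * √q / ε * (2 * a * R' * a) * (a * R' * √r) with hC
  have hC0 : 0 ≤ C := by positivity
  refine ⟨Real.toNNReal C, LipschitzOnWith.of_dist_le_mul fun x hx y hy => ?_⟩
  rw [Real.coe_toNNReal _ hC0, Real.dist_eq, dist_eq_norm]
  set wx := g x / (g x + ε) with hwx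
  set wy := g y / (g y + ε) with hwy
  have hwx0 : 0 ≤ wx := div_nonneg (hg0 x) (add_nonneg (hg0 x) hε.le)
  have hwx1 : wx ≤ 1 := div_le_one_of_le₀ (by linarith) (add_nonneg (hg0 x) hε.le)
  set f : (Fin n × Fin q → ℝ) → Matrix (Fin n) (Fin q) ℝ := fun x => B x * headProj (U x) r with hf
  have hreg : regFit X S hk r ε x ij - regFit X S hk r ε y ij
      = wx * (f x - f y) ij.1 ij.2 + (wx - wy) * f y ij.1 ij.2 := by
    simp only [regFit, rrFit_eq hk hr.le]
    change wx * f x ij.1 ij.2 - wy * f y ij.1 ij.2 = _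
    rw [Matrix.sub_apply]
    ring
  have hfy : ‖f y‖ ≤ a * R' * √r := (frobenius_norm_mul _ _).trans
    (mul_le_mul (hball y hy) (hproj y) (norm_nonneg _) (by positivity))
  have hfxy : ‖f x - f y‖ ≤ a * ‖x - y‖ * √r + a * R' * ‖headProj (U x) r - headProj (U y) r‖ := by
    have e : f x - f y = (B x - B y) * headProj (U x) r
        + B y * (headProj (U x) r - headProj (U y) r) := by
      simp only [hf, Matrix.sub_mul, Matrix.mul_sub]; abel
    rw [e]
    refine (norm_add_le _ _).trans (add_le_add ?_ ?_)
    · exact (frobenius_norm_mul _ _).trans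
        (mul_le_mul (hfit' x y) (hproj x) (norm_nonneg _) (by positivity))
    · exact (frobenius_norm_mul _ _).trans
        (mul_le_mul_of_nonneg_right (hball y hy) (norm_nonneg _))
  have h1 : |wx * (f x - f y) ij.1 ij.2|
      ≤ a * ‖x - y‖ * √r + a * R' * (2 / ε * (2 * a * R' * a * ‖x - y‖)) := by
    rw [abs_mul, abs_of_nonneg hwx0]
    calc wx * |(f x - f y) ij.1 ij.2| ≤ wx * ‖f x - f y‖ :=
          mul_le_mul_of_nonneg_left (abs_apply_le_frobenius _ _ _) hwx0
      _ ≤ wx * (a * ‖x - y‖ * √r + a * R' * ‖headProj (U x) r - headProj (U y) r‖) :=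
          mul_le_mul_of_nonneg_left hfxy hwx0
      _ = wx * (a * ‖x - y‖ * √r) + a * R' * (wx * ‖headProj (U x) r - headProj (U y) r‖) := by ring
      _ ≤ a * ‖x - y‖ * √r + a * R' * (2 / ε * (2 * a * R' * a * ‖x - y‖)) := by
          refine add_le_add (mul_le_of_le_one_left (by positivity) hwx1)
            (mul_le_mul_of_nonneg_left ((hweight x y).trans ?_) (by positivity))
          exact mul_le_mul_of_nonneg_left (hgram x hx y hy) (by positivity)
  have h2 : |(wx - wy) * f y ij.1 ij.2|
      ≤ (4 * √q / ε * (2 * a * R' * a * ‖x - y‖)) * (a * R' * √r) := by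
    rw [abs_mul]
    refine mul_le_mul ?_ ((abs_apply_le_frobenius _ _ _).trans hfy) (abs_nonneg _) (by positivity)
    exact (hweight' x y).trans (mul_le_mul_of_nonneg_left (hgram x hx y hy) (by positivity))
  rw [hreg]
  refine (abs_add_le _ _).trans ((add_le_add h1 h2).trans_eq ?_)
  rw [hC]
  ring

end Bounds

/-! ### Stein's identity for the reduced-rank fit -/

section GaussianVectorFit

open Filter Topology Metric

theorem hasMatDeriv_vecToMatrix {n q : ℕ} (x : Fin n × Fin q → ℝ) :
    HasMatDeriv vecToMatrix vecToMatrix x := fun i j =>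
  ⟨ContinuousLinearMap.proj (R := ℝ) (φ := fun _ : Fin n × Fin q => ℝ) (i, j),
    (ContinuousLinearMap.proj (R := ℝ) (φ := fun _ : Fin n × Fin q => ℝ) (i, j)).hasFDerivAt,
    fun _ => rfl⟩

theorem vecToMatrix_single {n q : ℕ} (i : Fin n) (j : Fin q) :
    vecToMatrix (Pi.single (i, j) 1) = Matrix.single i j (1 : ℝ) := by
  ext a b
  simp only [vecToMatrix, of_apply, Pi.single_apply, Matrix.single_apply, Prod.mk.injEq]
  exact if_congr ⟨fun h => ⟨h.1.symm, h.2.symm⟩, fun h => ⟨h.1.symm, h.2.symm⟩⟩ rfl rfl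

section Generic

variable {n p q k r : ℕ} {X : Matrix (Fin n) (Fin p) ℝ}
  {S : ∀ Y : Matrix (Fin n) (Fin q) ℝ, ThinSVD (lsFit X Y) k}

theorem lsFit_rrFit (hk : k ≤ q) (hr : r ≤ k) (Y : Matrix (Fin n) (Fin q) ℝ) :
    lsFit X (rrFit X S r Y) = rrFit X S r Y := by
  rw [rrFit_eq hk hr, lsFit, ← Matrix.mul_assoc, hat_mul_lsFit]

/-- The spectral gap is differentiable where the singular values are distinct and positive, and its
derivative in the direction of the fit itself is twice the square of the `r`-th singular value (which
has index `r - 1`): moving along the fit rescales the leading `r` singular values and leaves the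
others fixed. -/
theorem exists_hasFDerivAt_specGap (hk : k ≤ q) (hr0 : 1 ≤ r) (hr : r < k)
    {x : Fin n × Fin q → ℝ} (hd : StrictAnti (S (vecToMatrix x)).d)
    (hpos : ∀ i, 0 < (S (vecToMatrix x)).d i) :
    ∃ g' : (Fin n × Fin q → ℝ) →L[ℝ] ℝ,
      HasFDerivAt (fun y => specGap ((S (vecToMatrix y)).eig hk) r) g' x ∧
      g' (fun ij => rrFit X S r (vecToMatrix x) ij.1 ij.2)
        = 2 * (S (vecToMatrix x)).d ⟨r - 1, by omega⟩ ^ 2 := by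
  set T := S (vecToMatrix x) with hT
  have hfull := T.isFullDecomp hk
  set A' : (Fin n × Fin q → ℝ) → Matrix (Fin q) (Fin q) ℝ := fun H =>
    (lsFit X (vecToMatrix H))ᵀ * lsFit X (vecToMatrix x)
      + (lsFit X (vecToMatrix x))ᵀ * lsFit X (vecToMatrix H) with hA'
  have key : ∀ j ≤ k, ∃ g' : (Fin n × Fin q → ℝ) →L[ℝ] ℝ,
      HasFDerivAt (fun y => headSum ((S (vecToMatrix y)).eig hk) j) g' x ∧
        ∀ H, g' H = trace (A' H * headProj (T.basis hk) j) := fun j hj => by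
    obtain ⟨c, γ, hγ, h1, h2⟩ := hfull.exists_gap hd hpos hj
    exact exists_hasFDerivAt_headSum (hj.trans hk)
      (fun y => ((S (vecToMatrix y)).isFullDecomp hk).eigen)
      (hasMatDeriv_gram_lsFit hasMatDeriv_vecToMatrix x) hγ h1 h2
  obtain ⟨g₀, h₀, e₀⟩ := key r hr.le
  obtain ⟨g₁, h₁, e₁⟩ := key (r - 1) (by omega)
  obtain ⟨g₂, h₂, e₂⟩ := key (r + 1) hr
  refine ⟨(2 : ℝ) • g₀ - g₁ - g₂, ((h₀.const_mul 2).sub h₁).sub h₂, ?_⟩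
  have hf : A' (fun ij => rrFit X S r (vecToMatrix x) ij.1 ij.2)
      = headProj (T.basis hk) r * ((lsFit X (vecToMatrix x))ᵀ * lsFit X (vecToMatrix x))
        + (lsFit X (vecToMatrix x))ᵀ * lsFit X (vecToMatrix x) * headProj (T.basis hk) r := by
    have e : lsFit X (vecToMatrix fun ij => rrFit X S r (vecToMatrix x) ij.1 ij.2)
        = lsFit X (vecToMatrix x) * headProj (T.basis hk) r := by
      change lsFit X (rrFit X S r (vecToMatrix x)) = _
      rw [lsFit_rrFit hk hr.le, rrFit_eq hk hr.le]
    simp only [hA']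
    rw [e, transpose_mul,
      (isRankProj_headProj (hr.le.trans hk) hfull.eigen.orth).symm, Matrix.mul_assoc,
      Matrix.mul_assoc]
  have hs : headSum (T.eig hk) r = headSum (T.eig hk) (r - 1) + T.d ⟨r - 1, by omega⟩ ^ 2 := by
    have h := headSum_succ (T.eig hk) (show r - 1 < q by omega)
    have h' : T.eig hk ⟨r - 1, by omega⟩ = T.d ⟨r - 1, by omega⟩ ^ 2 :=
      hfull.head ⟨r - 1, by omega⟩
    rw [h', Nat.sub_add_cancel hr0] at h
    exact h
  simp only [_root_.sub_apply, _root_.smul_apply, smul_eq_mul]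
  rw [e₀, e₁, e₂, hf, hfull.eigen.trace_headProj_anticomm, hfull.eigen.trace_headProj_anticomm,
    hfull.eigen.trace_headProj_anticomm, min_self, min_eq_right (by omega : r - 1 ≤ r),
    min_eq_left (by omega : r ≤ r + 1), hs]
  ring

/-- All `r = k` singular directions together reproduce the least squares fit. -/
theorem rrFit_self (Y : Matrix (Fin n) (Fin q) ℝ) : rrFit X S k Y = lsFit X Y := by
  have h : (∑ i : Fin k with i.val < k,
      vecMulVec (fun j => (S Y).V j i) (fun j => (S Y).V j i)) = (S Y).V * (S Y).Vᵀ := by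
    rw [Finset.filter_true_of_mem fun i _ => i.2]
    ext a b
    simp [Matrix.sum_apply, Matrix.mul_apply, vecMulVec_apply]
  rw [rrFit, h]
  calc lsFit X Y * ((S Y).V * (S Y).Vᵀ)
      = (S Y).W * diagonal (S Y).d * (S Y).Vᵀ * ((S Y).V * (S Y).Vᵀ) :=
        congrArg (· * ((S Y).V * (S Y).Vᵀ)) (S Y).eq_mul
    _ = (S Y).W * diagonal (S Y).d * ((S Y).Vᵀ * (S Y).V) * (S Y).Vᵀ := by
        simp only [Matrix.mul_assoc]
    _ = lsFit X Y := by rw [(S Y).orthonormal_V, Matrix.mul_one, ← (S Y).eq_mul]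

end Generic

variable {n p q r : ℕ} {X : Matrix (Fin n) (Fin p) ℝ}
  {S : ∀ Y : Matrix (Fin n) (Fin q) ℝ, ThinSVD (lsFit X Y) (min X.rank q)}

theorem dfHat_nonneg {rx : ℕ} {d : Fin (min rx q) → ℝ} (hd : StrictAnti d) (hpos : ∀ i, 0 < d i)
    (hr : r ≤ min rx q) : 0 ≤ dfHat rx q r d := by
  refine le_trans (mul_nonneg ?_ (Nat.cast_nonneg r)) (le_dfHat hd hpos hr)
  have h1 : (r : ℝ) ≤ q := by exact_mod_cast hr.trans (min_le_right _ _)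
  have h2 : (0 : ℝ) ≤ rx := Nat.cast_nonneg _
  linarith

/-- The divergence of the fit, as a function on `Fin n × Fin q → ℝ`. -/
theorem exists_hasFDerivAt_rrFit_vecToMatrix (hr : r ≤ min X.rank q) {x : Fin n × Fin q → ℝ}
    (hd : StrictAnti (S (vecToMatrix x)).d) (hpos : ∀ i, 0 < (S (vecToMatrix x)).d i) :
    ∃ f' : Fin n × Fin q → (Fin n × Fin q → ℝ) →L[ℝ] ℝ,
      (∀ ij, HasFDerivAt (fun y => rrFit X S r (vecToMatrix y) ij.1 ij.2) (f' ij) x) ∧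
      ∑ ij, f' ij (Pi.single ij 1) = dfHat X.rank q r (S (vecToMatrix x)).d := by
  choose d h1 h2 using hasMatDeriv_rrFit hasMatDeriv_vecToMatrix (min_le_right _ _) hr hd hpos
  refine ⟨fun ij => d ij.1 ij.2, fun ij => h1 ij.1 ij.2, ?_⟩
  rw [← sum_rrDeriv_eq_dfHat hr hpos, Fintype.sum_prod_type]
  refine Finset.sum_congr rfl fun i _ => Finset.sum_congr rfl fun j _ => ?_
  rw [← vecToMatrix_single]
  exact h2 i j _

/-- The divergence of the regularised fit: the product rule adds the derivative of the weight in
the direction of the fit. -/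
theorem exists_hasFDerivAt_regFit (hr0 : 1 ≤ r) (hr : r < min X.rank q) {ε : ℝ} (hε : 0 < ε)
    {x : Fin n × Fin q → ℝ} (hd : StrictAnti (S (vecToMatrix x)).d)
    (hpos : ∀ i, 0 < (S (vecToMatrix x)).d i) :
    ∃ f' : Fin n × Fin q → (Fin n × Fin q → ℝ) →L[ℝ] ℝ,
      (∀ ij, HasFDerivAt (fun y => regFit X S (min_le_right _ _) r ε y ij) (f' ij) x) ∧
      ∑ ij, f' ij (Pi.single ij 1)
        = specGap ((S (vecToMatrix x)).eig (min_le_right _ _)) r /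
            (specGap ((S (vecToMatrix x)).eig (min_le_right _ _)) r + ε) *
            dfHat X.rank q r (S (vecToMatrix x)).d
          + ε / (specGap ((S (vecToMatrix x)).eig (min_le_right _ _)) r + ε) ^ 2 *
            (2 * (S (vecToMatrix x)).d ⟨r - 1, by omega⟩ ^ 2) := by
  set g : (Fin n × Fin q → ℝ) → ℝ :=
    fun y => specGap ((S (vecToMatrix y)).eig (min_le_right _ _)) r with hg
  obtain ⟨f', hf, hsum⟩ := exists_hasFDerivAt_rrFit_vecToMatrix hr.le hd hpos
  obtain ⟨g', hg', hgf⟩ := exists_hasFDerivAt_specGap (min_le_right _ _) hr0 hr hd hpos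
  have hgx : 0 ≤ g x := specGap_nonneg ((S (vecToMatrix x)).isFullDecomp
    (min_le_right _ _)).eigen.anti hr0 (hr.trans_le (min_le_right _ _))
  have hne : g x + ε ≠ 0 := by positivity
  have hψ : HasDerivAt (fun t : ℝ => t / (t + ε)) (ε / (g x + ε) ^ 2) (g x) := by
    refine ((hasDerivAt_id (g x)).div ((hasDerivAt_id (g x)).add_const ε) hne).congr_deriv ?_
    simp only [id]
    congr 1
    ring
  have hw : HasFDerivAt (fun y => g y / (g y + ε)) ((ε / (g x + ε) ^ 2) • g') x :=
    hψ.comp_hasFDerivAt x hg'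
  refine ⟨_, fun ij => hw.mul (hf ij), ?_⟩
  have hlin : ∑ ij, g' (Pi.single ij 1) * rrFit X S r (vecToMatrix x) ij.1 ij.2
      = 2 * (S (vecToMatrix x)).d ⟨r - 1, by omega⟩ ^ 2 := by
    rw [← hgf]
    conv_rhs => rw [← Finset.univ_sum_single
      (fun ij : Fin n × Fin q => rrFit X S r (vecToMatrix x) ij.1 ij.2), map_sum]
    refine Finset.sum_congr rfl fun ij _ => ?_
    rw [mul_comm, ← smul_eq_mul, ← map_smul, ← Pi.single_smul, smul_eq_mul, mul_one]
  simp only [_root_.add_apply, _root_.smul_apply, smul_eq_mul]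
  rw [Finset.sum_add_distrib, ← Finset.mul_sum, hsum, ← hlin, Finset.mul_sum]
  congr 1
  exact Finset.sum_congr rfl fun ij _ => by ring

theorem specGap_eig_eq {k : ℕ} {B : Matrix (Fin n) (Fin q) ℝ} (T : ThinSVD B k) (hk : k ≤ q)
    (hr0 : 1 ≤ r) (hr : r < k) :
    specGap (T.eig hk) r = T.d ⟨r - 1, by omega⟩ ^ 2 - T.d ⟨r, hr⟩ ^ 2 := by
  rw [specGap_eq _ hr0 (hr.trans_le hk)]
  exact congrArg₂ (· - ·) ((T.isFullDecomp hk).head ⟨r - 1, by omega⟩)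
    ((T.isFullDecomp hk).head ⟨r, hr⟩)

theorem specGap_eig_pos {k : ℕ} {B : Matrix (Fin n) (Fin q) ℝ} {T : ThinSVD B k} (hk : k ≤ q)
    (hr0 : 1 ≤ r) (hr : r < k) (hd : StrictAnti T.d) : 0 < specGap (T.eig hk) r := by
  rw [specGap_eig_eq T hk hr0 hr, sub_pos]
  exact pow_lt_pow_left₀ (hd (Fin.lt_def.2 (by simp; omega))) (T.nonneg_d _) two_ne_zero

theorem abs_regFit_le {k : ℕ} {S : ∀ Y : Matrix (Fin n) (Fin q) ℝ, ThinSVD (lsFit X Y) k}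
    (hk : k ≤ q) (hr0 : 1 ≤ r) (hr : r < k) {ε : ℝ} (hε : 0 < ε) (x : Fin n × Fin q → ℝ)
    (ij : Fin n × Fin q) :
    |regFit X S hk r ε x ij| ≤ |rrFit X S r (vecToMatrix x) ij.1 ij.2| := by
  have hg : 0 ≤ specGap ((S (vecToMatrix x)).eig hk) r :=
    specGap_nonneg ((S (vecToMatrix x)).isFullDecomp hk).eigen.anti hr0 (hr.trans_le hk)
  rw [regFit, abs_mul, abs_of_nonneg (div_nonneg hg (by positivity))]
  exact mul_le_of_le_one_left (abs_nonneg _) (div_le_one_of_le₀ (by linarith) (by positivity))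

theorem tendsto_div_add_one_div {t : ℝ} (ht : 0 < t) :
    Tendsto (fun N : ℕ => t / (t + 1 / ((N : ℝ) + 1))) atTop (𝓝 1) := by
  have h := (tendsto_const_nhds (x := t)).div
    ((tendsto_one_div_add_atTop_nhds_zero_nat (𝕜 := ℝ)).const_add t) (by simpa using ht.ne')
  rw [add_zero, div_self ht.ne'] at h
  exact h

theorem tendsto_regFit {k : ℕ} {S : ∀ Y : Matrix (Fin n) (Fin q) ℝ, ThinSVD (lsFit X Y) k}
    (hk : k ≤ q) (hr0 : 1 ≤ r) (hr : r < k) {x : Fin n × Fin q → ℝ}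
    (hd : StrictAnti (S (vecToMatrix x)).d) (ij : Fin n × Fin q) :
    Tendsto (fun N : ℕ => regFit X S hk r (1 / ((N : ℝ) + 1)) x ij) atTop
      (𝓝 (rrFit X S r (vecToMatrix x) ij.1 ij.2)) := by
  simpa [regFit] using (tendsto_div_add_one_div (specGap_eig_pos hk hr0 hr hd)).mul_const
    (rrFit X S r (vecToMatrix x) ij.1 ij.2)

theorem exists_lipschitzOnWith_lsFit_vecToMatrix (X : Matrix (Fin n) (Fin p) ℝ)
    (ij : Fin n × Fin q) (R : ℝ) : ∃ C : ℝ≥0, LipschitzOnWith C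
      (fun x : Fin n × Fin q → ℝ => lsFit X (vecToMatrix x) ij.1 ij.2) (closedBall 0 R) := by
  obtain ⟨a, ha, -, h⟩ := exists_norm_lsFit_vecToMatrix_le (q := q) X
  refine ⟨⟨a, ha⟩, LipschitzOnWith.of_dist_le_mul fun x _ y _ => ?_⟩
  rw [Real.dist_eq, dist_eq_norm, ← Matrix.sub_apply]
  exact (abs_apply_le_frobenius _ _ _).trans (h x y)

theorem aestronglyMeasurable_rrFit_vecToMatrix (hr0 : 1 ≤ r) (hr : r ≤ min X.rank q)
    (ij : Fin n × Fin q) :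
    AEStronglyMeasurable (fun x : Fin n × Fin q → ℝ => rrFit X S r (vecToMatrix x) ij.1 ij.2)
      volume := by
  rcases hr.lt_or_eq with hlt | rfl
  · refine aestronglyMeasurable_of_tendsto_ae atTop (fun N : ℕ =>
      (continuous_of_lipschitzOnWith_closedBall fun R => exists_lipschitzOnWith_regFit (X := X)
        (S := S) (min_le_right _ _) hr0 hlt (Nat.one_div_pos_of_nat (n := N)) ij
          R).aestronglyMeasurable) ?_
    filter_upwards [ae_strictAnti_and_pos X S] with x hx
    exact tendsto_regFit (min_le_right _ _) hr0 hlt hx.1 ij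
  · simp only [rrFit_self]
    exact (continuous_of_lipschitzOnWith_closedBall fun R =>
      exists_lipschitzOnWith_lsFit_vecToMatrix X ij R).aestronglyMeasurable

variable (m : Fin n × Fin q → ℝ) {v : ℝ≥0}

theorem memLp_rrFit_gaussianVector (hv : v ≠ 0) (hr0 : 1 ≤ r) (hr : r ≤ min X.rank q)
    (ij : Fin n × Fin q) :
    MemLp (fun x => rrFit X S r (vecToMatrix x) ij.1 ij.2) 2 (gaussianVector m v) := by
  obtain ⟨K, hK⟩ := exists_abs_rrFit_vecToMatrix_le (S := S) (min_le_right _ _) hr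
  refine ((memLp_norm_gaussianVector m).const_mul K).mono
    ((aestronglyMeasurable_rrFit_vecToMatrix hr0 hr ij).mono_ac
      (gaussianVector_absolutelyContinuous m hv)) (Eventually.of_forall fun x => ?_)
  exact (hK x ij).trans (le_abs_self _)

/-- Stein's identity for the fit of full rank, which is linear in the response. -/
theorem integrable_and_integral_dfHat_of_eq (hv : v ≠ 0) (hr : r = min X.rank q) :
    Integrable (fun x => dfHat X.rank q r (S (vecToMatrix x)).d) (gaussianVector m v) ∧
    ∫ x, dfHat X.rank q r (S (vecToMatrix x)).d ∂gaussianVector m v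
      = (v : ℝ)⁻¹ * ∫ x, ∑ ij : Fin n × Fin q, rrFit X S r (vecToMatrix x) ij.1 ij.2 *
          (x ij - m ij) ∂gaussianVector m v := by
  obtain ⟨K, hK⟩ := exists_abs_rrFit_vecToMatrix_le (S := S) (min_le_right _ _) hr.le
  refine integrable_and_integral_divergence_gaussianVector m hv
    (F := fun x ij => rrFit X S r (vecToMatrix x) ij.1 ij.2) (fun ij R => ?_) hK ?_ ?_ ?_
  · subst hr
    simp only [rrFit_self]
    exact exists_lipschitzOnWith_lsFit_vecToMatrix X ij R
  · filter_upwards [ae_strictAnti_and_pos X S] with x hx ij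
    obtain ⟨f', h1, -⟩ := exists_hasFDerivAt_rrFit_vecToMatrix hr.le hx.1 hx.2
    exact (h1 ij).differentiableAt
  · filter_upwards [ae_strictAnti_and_pos X S] with x hx
    obtain ⟨f', h1, h2⟩ := exists_hasFDerivAt_rrFit_vecToMatrix hr.le hx.1 hx.2
    rw [← h2]
    exact Finset.sum_congr rfl fun ij _ => ((h1 ij).hasLineDerivAt _).lineDeriv
  · filter_upwards [ae_strictAnti_and_pos X S] with x hx
    exact dfHat_nonneg hx.1 hx.2 hr.le

/-- Stein's identity for the truncated fit, as the limit of the identities for the regularised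
fits. Their divergences are nonnegative and converge to `dfHat`, so Fatou's lemma makes `dfHat`
integrable; they are at most `3 dfHat`, so the integrals converge by domination. -/
theorem integrable_and_integral_dfHat_of_lt (hv : v ≠ 0) (hr0 : 1 ≤ r) (hr : r < min X.rank q) :
    Integrable (fun x => dfHat X.rank q r (S (vecToMatrix x)).d) (gaussianVector m v) ∧
    ∫ x, dfHat X.rank q r (S (vecToMatrix x)).d ∂gaussianVector m v
      = (v : ℝ)⁻¹ * ∫ x, ∑ ij : Fin n × Fin q, rrFit X S r (vecToMatrix x) ij.1 ij.2 *
          (x ij - m ij) ∂gaussianVector m v := by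
  set μ := gaussianVector m v with hμ
  have hac : μ ≪ volume := gaussianVector_absolutelyContinuous m hv
  have hgen := ae_strictAnti_and_pos X S
  obtain ⟨K, hK⟩ := exists_abs_rrFit_vecToMatrix_le (S := S) (min_le_right _ _) hr.le
  set g : (Fin n × Fin q → ℝ) → ℝ :=
    fun x => specGap ((S (vecToMatrix x)).eig (min_le_right _ _)) r with hg
  set df : (Fin n × Fin q → ℝ) → ℝ := fun x => dfHat X.rank q r (S (vecToMatrix x)).d with hdf
  set s : (Fin n × Fin q → ℝ) → ℝ :=
    fun x => (S (vecToMatrix x)).d ⟨r - 1, by omega⟩ ^ 2 with hs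
  set ε : ℕ → ℝ := fun N => 1 / ((N : ℝ) + 1) with hε
  have hε0 : ∀ N, 0 < ε N := fun N => Nat.one_div_pos_of_nat
  set F : ℕ → (Fin n × Fin q → ℝ) → Fin n × Fin q → ℝ :=
    fun N x ij => regFit X S (min_le_right _ _) r (ε N) x ij with hF
  set D : ℕ → (Fin n × Fin q → ℝ) → ℝ := fun N x =>
    g x / (g x + ε N) * df x + ε N / (g x + ε N) ^ 2 * (2 * s x) with hD
  have hgpos : ∀ x, StrictAnti (S (vecToMatrix x)).d → 0 < g x := fun x hx =>
    specGap_eig_pos (min_le_right _ _) hr0 hr hx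
  have hDnn : ∀ N, ∀ᵐ x, 0 ≤ D N x := fun N => by
    filter_upwards [hgen] with x hx
    have h1 := hgpos x hx.1
    have h2 : 0 ≤ df x := dfHat_nonneg hx.1 hx.2 hr.le
    have h3 : 0 ≤ s x := sq_nonneg _
    have h4 := hε0 N
    positivity
  have hFlip : ∀ N ij, ∀ R : ℝ, ∃ C : ℝ≥0, LipschitzOnWith C (fun x => F N x ij) (closedBall 0 R) :=
    fun N ij R => exists_lipschitzOnWith_regFit (min_le_right _ _) hr0 hr (hε0 N) ij R
  have hFle : ∀ N x ij, |F N x ij| ≤ K * ‖x‖ := fun N x ij =>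
    (abs_regFit_le (min_le_right _ _) hr0 hr (hε0 N) x ij).trans (hK x ij)
  have hstein : ∀ N, Integrable (D N) μ ∧
      ∫ x, D N x ∂μ = (v : ℝ)⁻¹ * ∫ x, ∑ ij, F N x ij * (x ij - m ij) ∂μ := fun N => by
    refine integrable_and_integral_divergence_gaussianVector m hv (hFlip N) (hFle N) ?_ ?_ (hDnn N)
    · filter_upwards [hgen] with x hx ij
      obtain ⟨f', h1, -⟩ := exists_hasFDerivAt_regFit hr0 hr (hε0 N) hx.1 hx.2
      exact (h1 ij).differentiableAt
    · filter_upwards [hgen] with x hx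
      obtain ⟨f', h1, h2⟩ := exists_hasFDerivAt_regFit hr0 hr (hε0 N) hx.1 hx.2
      rw [hD]
      simp only [hg, hdf, hs]
      rw [← h2]
      exact Finset.sum_congr rfl fun ij _ => ((h1 ij).hasLineDerivAt _).lineDeriv
  have hε_lim : Tendsto ε atTop (𝓝 0) := tendsto_one_div_add_atTop_nhds_zero_nat
  have hDlim : ∀ᵐ x ∂μ, Tendsto (fun N => D N x) atTop (𝓝 (df x)) := by
    filter_upwards [hac.ae_le hgen] with x hx
    have h1 := hgpos x hx.1
    have h2 : Tendsto (fun N => ε N / (g x + ε N) ^ 2) atTop (𝓝 0) := by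
      have := hε_lim.div ((hε_lim.const_add (g x)).pow 2) (by simpa using h1.ne')
      rwa [zero_div] at this
    have h3 := ((tendsto_div_add_one_div h1).mul_const (df x)).add (h2.mul_const (2 * s x))
    rw [one_mul, zero_mul, add_zero] at h3
    exact h3
  have hmem : ∀ ij : Fin n × Fin q, MemLp (fun x : Fin n × Fin q → ℝ => x ij - m ij) 2 μ :=
    fun ij => (memLp_eval_gaussianVector m ij).sub (memLp_const _)
  have hRHS : Tendsto (fun N => ∫ x, ∑ ij, F N x ij * (x ij - m ij) ∂μ) atTop
      (𝓝 (∫ x, ∑ ij : Fin n × Fin q, rrFit X S r (vecToMatrix x) ij.1 ij.2 *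
        (x ij - m ij) ∂μ)) := by
    refine tendsto_integral_of_dominated_convergence
      (fun x => ∑ ij : Fin n × Fin q, ‖K * ‖x‖ * (x ij - m ij)‖) (fun N => ?_) ?_ (fun N => ?_) ?_
    · exact (continuous_finsetSum _ fun ij _ =>
        (continuous_of_lipschitzOnWith_closedBall (hFlip N ij)).mul
          ((continuous_apply ij).sub continuous_const)).aestronglyMeasurable
    · exact integrable_finsetSum _ fun ij _ =>
        (((memLp_norm_gaussianVector m).const_mul K).integrable_mul (hmem ij)).norm
    · refine Eventually.of_forall fun x => (norm_sum_le _ _).trans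
        (Finset.sum_le_sum fun ij _ => ?_)
      rw [norm_mul, norm_mul]
      exact mul_le_mul_of_nonneg_right ((hFle N x ij).trans (le_abs_self _)) (norm_nonneg _)
    · filter_upwards [hac.ae_le hgen] with x hx
      exact tendsto_finsetSum _ fun ij _ =>
        (tendsto_regFit (min_le_right _ _) hr0 hr hx.1 ij).mul_const _
  have hL : Tendsto (fun N => ∫ x, D N x ∂μ) atTop
      (𝓝 ((v : ℝ)⁻¹ * ∫ x, ∑ ij : Fin n × Fin q, rrFit X S r (vecToMatrix x) ij.1 ij.2 *
        (x ij - m ij) ∂μ)) := by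
    simp only [fun N => (hstein N).2]
    exact hRHS.const_mul _
  have hint : Integrable df μ := integrable_of_tendsto_of_tendsto_integral (fun N => (hstein N).1)
    (fun N => hac.ae_le (hDnn N)) hDlim hL
  refine ⟨hint, tendsto_nhds_unique ?_ hL⟩
  refine tendsto_integral_of_dominated_convergence (fun x => 3 * df x)
    (fun N => (hstein N).1.aestronglyMeasurable) (hint.const_mul 3) (fun N => ?_) hDlim
  filter_upwards [hac.ae_le hgen, hac.ae_le (hDnn N)] with x hx hx0
  have h1 := hgpos x hx.1
  have h2 : 0 ≤ df x := dfHat_nonneg hx.1 hx.2 hr.le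
  have h4 := hε0 N
  have h3 : s x / g x ≤ df x := by
    simp only [hg, hs, specGap_eig_eq (S (vecToMatrix x)) (min_le_right _ _) hr0 hr]
    exact boundary_term_le_dfHat hx.1 hx.2 hr (by simp; omega)
  rw [Real.norm_of_nonneg hx0]
  have h5 : g x / (g x + ε N) * df x ≤ df x :=
    mul_le_of_le_one_left h2 (div_le_one_of_le₀ (by linarith) (by positivity))
  have h6 : ε N / (g x + ε N) ^ 2 * (2 * s x)
      = ε N * g x / (g x + ε N) ^ 2 * (2 * (s x / g x)) := by
    field_simp
  have h7 : ε N * g x / (g x + ε N) ^ 2 ≤ 1 :=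
    div_le_one_of_le₀ (by nlinarith [mul_pos h1 h4, sq_nonneg (g x), sq_nonneg (ε N)])
      (by positivity)
  have h8 : ε N * g x / (g x + ε N) ^ 2 * (2 * (s x / g x)) ≤ 2 * (s x / g x) :=
    mul_le_of_le_one_left (mul_nonneg zero_le_two (div_nonneg (sq_nonneg _) h1.le)) h7
  simp only [hD]
  linarith

theorem integrable_and_integral_dfHat (hv : v ≠ 0) (hr0 : 1 ≤ r) (hr : r ≤ min X.rank q) :
    Integrable (fun x => dfHat X.rank q r (S (vecToMatrix x)).d) (gaussianVector m v) ∧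
    ∫ x, dfHat X.rank q r (S (vecToMatrix x)).d ∂gaussianVector m v
      = (v : ℝ)⁻¹ * ∫ x, ∑ ij : Fin n × Fin q, rrFit X S r (vecToMatrix x) ij.1 ij.2 *
          (x ij - m ij) ∂gaussianVector m v :=
  hr.lt_or_eq.elim (integrable_and_integral_dfHat_of_lt m hv hr0)
    (integrable_and_integral_dfHat_of_eq m hv)

end GaussianVectorFit

theorem IsGaussianResponse.hasLaw_gaussianVector {n q : ℕ} {Ω : Type*} [MeasurableSpace Ω]
    {P : Measure Ω} [IsProbabilityMeasure P] {Y : Ω → Matrix (Fin n) (Fin q) ℝ}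
    {M : Matrix (Fin n) (Fin q) ℝ} {σ2 : ℝ≥0} (h : IsGaussianResponse P Y M σ2) :
    HasLaw (fun ω (ij : Fin n × Fin q) => Y ω ij.1 ij.2)
      (gaussianVector (fun ij => M ij.1 ij.2) σ2) P := by
  refine ⟨aemeasurable_pi_lambda _ fun ij => (h.hasLaw ij.1 ij.2).aemeasurable, ?_⟩
  rw [(iIndepFun_iff_map_fun_eq_pi_map fun ij : Fin n × Fin q =>
    (h.hasLaw ij.1 ij.2).aemeasurable).1 h.indep, gaussianVector]
  congr 1
  ext1 ij
  exact (h.hasLaw ij.1 ij.2).map_eq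

theorem theorem2 {n p q : ℕ} (X : Matrix (Fin n) (Fin p) ℝ)
    (S : ∀ Y : Matrix (Fin n) (Fin q) ℝ, ThinSVD (lsFit X Y) (min X.rank q))
    (r : ℕ) (hr1 : 1 ≤ r) (hr : r ≤ min X.rank q) :
    (∀ Y : Matrix (Fin n) (Fin q) ℝ, StrictAnti (S Y).d → (∀ k, 0 < (S Y).d k) →
      DifferentiableAt ℝ (rrFit X S r) Y ∧
      divergence (rrFit X S r) Y = dfHat X.rank q r (S Y).d ∧
      ((X.rank : ℝ) + q - r) * r ≤ dfHat X.rank q r (S Y).d) ∧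
    (∀ {Ω : Type*} [MeasurableSpace Ω] (P : Measure Ω) [IsProbabilityMeasure P]
      (Y : Ω → Matrix (Fin n) (Fin q) ℝ) (M : Matrix (Fin n) (Fin q) ℝ) (σ2 : ℝ≥0),
      0 < σ2 → IsGaussianResponse P Y M σ2 →
      (∀ᵐ ω ∂P, StrictAnti (S (Y ω)).d ∧ ∀ k, 0 < (S (Y ω)).d k) ∧
      (∀ i j, MemLp (fun ω => rrFit X S r (Y ω) i j) 2 P) ∧
      Integrable (fun ω => dfHat X.rank q r (S (Y ω)).d) P ∧
      ∫ ω, dfHat X.rank q r (S (Y ω)).d ∂P = effectiveDF P Y σ2 (rrFit X S r)) := by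
  refine ⟨fun Y hd hpos => ?_, fun {Ω} _ P _ Y M σ2 hσ hY => ?_⟩
  · obtain ⟨h1, h2⟩ := differentiableAt_rrFit_and_divergence_eq hr hd hpos
    exact ⟨h1, h2, le_dfHat hd hpos hr⟩
  set m : Fin n × Fin q → ℝ := fun ij => M ij.1 ij.2 with hm
  have hlaw := hY.hasLaw_gaussianVector
  have hmap := hlaw.map_eq
  have hmeas := hlaw.aemeasurable
  obtain ⟨hint, heq⟩ := integrable_and_integral_dfHat (S := S) m hσ.ne' hr1 hr
  have hmem := memLp_rrFit_gaussianVector (S := S) m hσ.ne' hr1 hr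
  rw [← hmap] at hint heq hmem
  have hmemY : ∀ i j, MemLp (fun ω => rrFit X S r (Y ω) i j) 2 P := fun i j =>
    (hmem (i, j)).comp_of_map hmeas
  have hmemE : ∀ i j, MemLp (fun ω => Y ω i j) 2 P := fun i j =>
    ((hlaw.map_eq ▸ memLp_eval_gaussianVector (v := σ2) m (i, j) :
      MemLp (fun x : Fin n × Fin q → ℝ => x (i, j)) 2
        (P.map fun ω (ij : Fin n × Fin q) => Y ω ij.1 ij.2))).comp_of_map hmeas
  refine ⟨?_, hmemY, hint.comp_aemeasurable hmeas, ?_⟩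
  · refine ae_of_ae_map (p := fun x => StrictAnti (S (vecToMatrix x)).d ∧
      ∀ k, 0 < (S (vecToMatrix x)).d k) hmeas ?_
    rw [hmap]
    exact (gaussianVector_absolutelyContinuous m hσ.ne').ae_le (ae_strictAnti_and_pos X S)
  rw [integral_map hmeas hint.aestronglyMeasurable] at heq
  have hsum : AEStronglyMeasurable (fun x : Fin n × Fin q → ℝ => ∑ ij : Fin n × Fin q,
      rrFit X S r (vecToMatrix x) ij.1 ij.2 * (x ij - m ij))
      (P.map fun ω (ij : Fin n × Fin q) => Y ω ij.1 ij.2) :=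
    Finset.aestronglyMeasurable_fun_sum _ fun ij _ => (hmem ij).aestronglyMeasurable.mul
      ((continuous_apply ij).sub continuous_const).aestronglyMeasurable
  rw [integral_map hmeas hsum] at heq
  refine heq.trans ?_
  have hcov : ∀ i j, ∫ ω, rrFit X S r (Y ω) i j * (Y ω i j - M i j) ∂P
      = covariance (fun ω => rrFit X S r (Y ω) i j) (fun ω => Y ω i j) P := fun i j => by
    have hE : ∫ ω, Y ω i j ∂P = M i j := by
      rw [(hY.hasLaw i j).integral_eq, integral_id_gaussianReal]
    rw [covariance_eq_sub (hmemY i j) (hmemE i j), hE]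
    simp only [mul_sub]
    refine (integral_sub ((hmemY i j).integrable_mul (hmemE i j))
      (((hmemY i j).integrable one_le_two).mul_const (M i j))).trans ?_
    rw [integral_mul_const]
  have hint' : ∀ ij : Fin n × Fin q,
      Integrable (fun ω => rrFit X S r (Y ω) ij.1 ij.2 * (Y ω ij.1 ij.2 - M ij.1 ij.2)) P :=
    fun ij => (hmemY ij.1 ij.2).integrable_mul ((hmemE ij.1 ij.2).sub (memLp_const _))
  have hpush : ∫ ω, ∑ ij : Fin n × Fin q,
      rrFit X S r (vecToMatrix fun ij => Y ω ij.1 ij.2) ij.1 ij.2 * (Y ω ij.1 ij.2 - m ij) ∂P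
      = ∑ i, ∑ j, covariance (fun ω => rrFit X S r (Y ω) i j) (fun ω => Y ω i j) P := by
    rw [← Fintype.sum_prod_type']
    simp only [← hcov]
    exact integral_finsetSum _ fun ij _ => hint' ij
  rw [hpush, effectiveDF, div_eq_inv_mul]
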